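/- Let $L$ be a finite-dimensional real Lie algebra with lower central series $L_1=L$, $L_{i+1}=[L,L_i]$. It is nilpotent of class $n\ge 1$ if $L_n\neq 0$ and $L_{n+1}=0$. A grading of such an $L$ is a decomposition $L=\bigoplus_{k=1}^n R_k$ into subspaces with $L_k=R_k\oplus L_{k+1}$ for all $k \ge 1$ and $[R_i,R_j]\subset R_{i+j}$, where $R_k=0$ for $k>n$. Theorem. Let $N$ be a (connected and) simply connected real Lie group whose Lie algebra $L$ is nilpotent of class $n$, and let $L=\bigoplus_{k=1}^n R_k$ be a grading of $L$. Then the exponential map $\exp:L\to N$ is a $C^\infty$ diffeomorphism, so that every element of $N$ is $\exp(a_1+\dots+a_n)$ for a unique sequence $a=(a_1,\dots,a_n)$ with $a_k\in R_k$, its canonical coordinates. In these coordinates the product of $N$ has the form $$a\cdot b=(a_1+b_1,\ a_2+b_2+p_2(a,b),\ \dots,\ a_n+b_n+p_n(a,b)),$$ where each $p_k$ is an $R_k$-valued polynomial map in $a_1,\dots,a_{k-1}$ and $b_1,\dots,b_{k-1}$ only, satisfying $p_k(a,0)=p_k(0,b)=0$ for all $a,b$. If $n=2$, then, identifying $N$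 with $L$ through $\exp$, $a\cdot b=a+b+\tfrac12[a,b]$. -/

import Mathlib

open scoped Manifold ContDiff

noncomputable section

/-- A `C^∞` real Lie group has the smoothness required by Mathlib's Lie bracket on its
tangent space at the identity. -/
instance instLEInftyMinSmoothnessReal : ENat.LEInfty (minSmoothness ℝ 3) where
  out := by
    rw [minSmoothness_of_isRCLikeNormedField]
    exact ENat.LEInfty.out

/-- The Lie algebra `L` is nilpotent of class `n`: its lower central series
`L_1 = L`, `L_{i+1} = [L, L_i]` satisfies `L_n ≠ 0` and `L_{n+1} = 0`.
(Mathlib's `lowerCentralSeries ℝ L L i` is `L_{i+1}`.) -/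
def IsNilpotentOfClass (L : Type*) [LieRing L] [LieAlgebra ℝ L] (n : ℕ) : Prop :=
  1 ≤ n ∧ LieModule.lowerCentralSeries ℝ L L (n - 1) ≠ ⊥ ∧
    LieModule.lowerCentralSeries ℝ L L n = ⊥

/-- `R` is a grading `L = R_1 ⊕ ⋯ ⊕ R_n` of a nilpotent Lie algebra `L` of class `n`:
`L_k = R_k ⊕ L_{k+1}` for all `k ≥ 1` and `[R_i, R_j] ⊆ R_{i+j}`, where `R_k = 0` for `k > n`.
The family is indexed by all natural numbers, `R_0` being zero. -/
structure IsLieGrading {L : Type*} [LieRing L] [LieAlgebra ℝ L] (n : ℕ)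
    (R : ℕ → Submodule ℝ L) : Prop where
  zero : R 0 = ⊥
  eq_bot_of_lt : ∀ k, n < k → R k = ⊥
  isInternal : DirectSum.IsInternal R
  sup_eq : ∀ k, R (k + 1) ⊔ (LieModule.lowerCentralSeries ℝ L L (k + 1)).toSubmodule =
    (LieModule.lowerCentralSeries ℝ L L k).toSubmodule
  disjoint : ∀ k, Disjoint (R (k + 1)) (LieModule.lowerCentralSeries ℝ L L (k + 1)).toSubmodule
  lie_mem : ∀ i j, ∀ x ∈ R i, ∀ y ∈ R j, ⁅x, y⁆ ∈ R (i + j)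

/-- A map `f : V → W` of finite-dimensional real vector spaces is polynomial: composed with any
linear functional on `W` it is a polynomial in linear functionals on `V`. -/
def IsPolynomialMap {V W : Type*} [AddCommGroup V] [Module ℝ V] [AddCommGroup W] [Module ℝ W]
    (f : V → W) : Prop :=
  ∀ φ : Module.Dual ℝ W, (fun v => φ (f v)) ∈
    Algebra.adjoin ℝ (Set.range fun ψ : Module.Dual ℝ V => (ψ : V → ℝ))

open Classical in
/-- The exponential map `exp : L → N` of a Lie group: `exp X = γ 1`, where `γ : ℝ → N` is the
integral curve through the identity of the left-invariant vector field of `X`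
(such a curve exists and is unique). -/
def lieExp {E : Type*} [NormedAddCommGroup E] [NormedSpace ℝ E]
    {N : Type*} [TopologicalSpace N] [ChartedSpace E N] [Group N]
    (X : GroupLieAlgebra 𝓘(ℝ, E) N) : N :=
  if h : ∃ γ : ℝ → N, γ 0 = 1 ∧
      IsMIntegralCurve (I := 𝓘(ℝ, E)) γ (mulInvariantVectorField (I := 𝓘(ℝ, E)) X)
  then h.choose 1 else 1

/-- The element of `N` with canonical coordinates `(a_1, …, a_n)`, `a_k ∈ R_k`, namely
`exp (a_1 + ⋯ + a_n)`. When `R` is a grading of class `n`, the entries `a_k` with `k = 0` or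
`k > n` lie in zero spaces, so `a` is just a sequence `(a_1, …, a_n)`. -/
def ofCanonicalCoordinates {E : Type*} [NormedAddCommGroup E] [NormedSpace ℝ E]
    {N : Type*} [TopologicalSpace N] [ChartedSpace E N] [Group N] (n : ℕ)
    (R : ℕ → Submodule ℝ (GroupLieAlgebra 𝓘(ℝ, E) N)) (a : ∀ k, R k) : N :=
  lieExp (∑ k ∈ Finset.Icc 1 n, (a k : GroupLieAlgebra 𝓘(ℝ, E) N))

/-- The space `R_1 × ⋯ × R_{k-1}` of coordinates of degree less than `k`
(the factor `R_0` is zero). -/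
abbrev LowerCoordinates {L : Type*} [AddCommGroup L] [Module ℝ L]
    (R : ℕ → Submodule ℝ L) (k : ℕ) : Type _ :=
  ∀ j : Set.Iio k, R j

/-- The coordinates `(a_1, …, a_{k-1})` of a sequence `a`. -/
def lowerCoordinates {L : Type*} [AddCommGroup L] [Module ℝ L]
    {R : ℕ → Submodule ℝ L} (a : ∀ k, R k) (k : ℕ) : LowerCoordinates R k :=
  fun j => a j

end

/-!
Write `E` for the model space of `N`, which is also its tangent space at the identity,
and `ad x = [x, ·]`.

**The derivative of `exp`.** In the chart at the identity, the bracket is the linearisation of the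
difference between left and right translations (`groupLieAlgebra_lie_eq`). For fixed `x` and small
`y`, the curve `s ↦ exp (-s x) * exp (s (x + y))`, read in this chart, solves a differential
equation whose linearisation at the origin is `b' = y - [x, b]`; the solution of the latter at
time `1` is `dexp x y`, where `dexp x = (1 - exp (-ad x)) / ad x`. A Grönwall estimate
(`IsNilpotentBracket.dexp_estimate`) shows that the two differ by `o(y)`, so `exp` has
left-trivialised derivative `dexp x` at `x` (`hasFDerivAt_idChart_exp`). As `ad x` is nilpotent,
`dexp x` is invertible and polynomial in `x`; hence `exp` is smooth, open and locally injective,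
and its inverse is smooth as soon as it exists (`exists_diffeomorph_modelExp`).

**The product.** The equation `c' = (dexp c)⁻¹ y`, `c 0 = x`, is polynomial, and each Picard
iterate is correct one step deeper in the lower central series than the previous one. So the
solution is reached after finitely many steps and is polynomial in `(t, x, y)`; `bchMul x y` is
its value at `t = 1`. By the formula for the derivative, `exp (c t)` and `exp x * exp (t y)` are
integral curves of the same left-invariant field, so `exp x * exp y = exp (bchMul x y)`
(`modelExp_mul_modelExp`).

**Bijectivity.** Since `exp` is locally injective, the group laws of `bchMul` follow from those of
`N` by connectedness of `E`. Thus `exp` is a surjective open homomorphism from the group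
`(E, bchMul)` with discrete kernel: a covering map, and so a bijection when `N` is simply connected
(`bijective_modelExp`).

**Canonical coordinates.** Changing `x` and `y` by elements of the `k`-th term of the lower
central series changes `bchMul x y - x - y` only by an element of the next term
(`IsNilpotentBracket.bchMul_sub_mem`). So the component of degree `k` of this polynomial depends
only on the components of `x` and `y` of degree less than `k`
(`IsNilpotentBracket.exists_graded_bchMul`). For class two the differential equation is solved
explicitly by `t ↦ x + t • (y + [x, y] / 2)`.
-/

/-! ### Polynomial maps -/

section PolynomialMaps

variable {U V W W₁ W₂ W₃ : Type*} [AddCommGroup U] [Module ℝ U] [AddCommGroup V] [Module ℝ V]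
  [AddCommGroup W] [Module ℝ W] [AddCommGroup W₁] [Module ℝ W₁] [AddCommGroup W₂] [Module ℝ W₂]
  [AddCommGroup W₃] [Module ℝ W₃]

namespace IsPolynomialMap

theorem const (w : W) : IsPolynomialMap (fun _ : V => w) := fun φ =>
  Subalgebra.algebraMap_mem _ (φ w)

theorem of_linear (f : V →ₗ[ℝ] W) : IsPolynomialMap f := fun φ =>
  Algebra.subset_adjoin ⟨φ ∘ₗ f, rfl⟩

theorem add {f g : V → W} (hf : IsPolynomialMap f) (hg : IsPolynomialMap g) :
    IsPolynomialMap (fun v => f v + g v) := fun φ => by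
  simpa only [map_add] using! Subalgebra.add_mem _ (hf φ) (hg φ)

theorem const_smul {f : V → W} (c : ℝ) (hf : IsPolynomialMap f) :
    IsPolynomialMap (fun v => c • f v) := fun φ => by
  simpa only [map_smul] using! Subalgebra.smul_mem _ (hf φ) c

theorem sub {f g : V → W} (hf : IsPolynomialMap f) (hg : IsPolynomialMap g) :
    IsPolynomialMap (fun v => f v - g v) := by
  simpa [sub_eq_add_neg] using hf.add (hg.const_smul (-1))

theorem sum {ι : Type*} (s : Finset ι) {f : ι → V → W} (hf : ∀ i ∈ s, IsPolynomialMap (f i)) :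
    IsPolynomialMap (fun v => ∑ i ∈ s, f i v) := by
  classical
  induction s using Finset.induction_on with
  | empty => simpa using const (V := V) (0 : W)
  | insert i s hi ih =>
    simp only [Finset.sum_insert hi]
    exact (hf i (Finset.mem_insert_self i s)).add
      (ih fun j hj => hf j (Finset.mem_insert_of_mem hj))

theorem linear_comp {f : V → W} (g : W →ₗ[ℝ] W₁) (hf : IsPolynomialMap f) :
    IsPolynomialMap (fun v => g (f v)) := fun φ => hf (φ ∘ₗ g)

theorem comp_linear {f : V → W} (hf : IsPolynomialMap f) (g : U →ₗ[ℝ] V) :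
    IsPolynomialMap (fun u => f (g u)) := fun φ => by
  have key : ∀ h ∈ Algebra.adjoin ℝ (Set.range fun ψ : Module.Dual ℝ V => (ψ : V → ℝ)),
      (fun u => h (g u)) ∈ Algebra.adjoin ℝ (Set.range fun ψ : Module.Dual ℝ U => (ψ : U → ℝ)) := by
    intro h hh
    induction hh using Algebra.adjoin_induction with
    | mem x hx =>
      obtain ⟨ψ, rfl⟩ := hx
      exact Algebra.subset_adjoin ⟨ψ ∘ₗ g, rfl⟩
    | algebraMap r => exact Subalgebra.algebraMap_mem _ r
    | add x y _ _ hx hy => exact Subalgebra.add_mem _ hx hy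
    | mul x y _ _ hx hy => exact Subalgebra.mul_mem _ hx hy
  exact key _ (hf φ)

theorem smul {f : V → ℝ} {g : V → W} (hf : IsPolynomialMap f) (hg : IsPolynomialMap g) :
    IsPolynomialMap (fun v => f v • g v) := fun φ => by
  simpa only [map_smul] using! Subalgebra.mul_mem _ (hf LinearMap.id) (hg φ)

theorem bilinear [FiniteDimensional ℝ W₁] {f : V → W₁} {g : V → W₂}
    (b : W₁ →ₗ[ℝ] W₂ →ₗ[ℝ] W₃) (hf : IsPolynomialMap f) (hg : IsPolynomialMap g) :
    IsPolynomialMap (fun v => b (f v) (g v)) := by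
  let B := Module.finBasis ℝ W₁
  have h : (fun v => b (f v) (g v)) = fun v => ∑ i, B.repr (f v) i • b (B i) (g v) := by
    funext v
    conv_lhs => rw [← B.sum_repr (f v)]
    simp only [map_sum, map_smul, LinearMap.sum_apply, LinearMap.smul_apply]
  rw [h]
  exact sum _ fun i _ => smul (linear_comp (B.coord i) hf) (linear_comp (b (B i)) hg)

end IsPolynomialMap

/-- A polynomial map between finite-dimensional spaces is continuous. -/
theorem IsPolynomialMap.continuous {V W : Type*} [NormedAddCommGroup V] [NormedSpace ℝ V]
    [FiniteDimensional ℝ V] [NormedAddCommGroup W] [NormedSpace ℝ W] [FiniteDimensional ℝ W]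
    {f : V → W} (hf : IsPolynomialMap f) : Continuous f := by
  have key : ∀ h ∈ Algebra.adjoin ℝ (Set.range fun ψ : Module.Dual ℝ V => (ψ : V → ℝ)),
      Continuous h := by
    intro h hh
    induction hh using Algebra.adjoin_induction with
    | mem x hx =>
      obtain ⟨ψ, rfl⟩ := hx
      exact ψ.continuous_of_finiteDimensional
    | algebraMap r => exact continuous_const
    | add x y _ _ hx hy => exact hx.add hy
    | mul x y _ _ hx hy => exact hx.mul hy
  let B := Module.finBasis ℝ W
  have h : f = fun v => ∑ i, B.repr (f v) i • B i := by
    funext v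
    rw [B.sum_repr]
  rw [h]
  exact continuous_finsetSum _ fun i _ => (key _ (hf (B.coord i))).smul continuous_const

end PolynomialMaps

section PolynomialCurves

variable (V W : Type*) [AddCommGroup V] [Module ℝ V] [NormedAddCommGroup W] [NormedSpace ℝ W]

/-- The families of curves `t ↦ g t v` in `W` that are polynomial in the time `t` with
coefficients polynomial in the parameter `v`: finite sums of `t ^ m • f v` with `f` polynomial. -/
def polynomialCurves : Submodule ℝ (ℝ → V → W) :=
  Submodule.span ℝ {g | ∃ (m : ℕ) (f : V → W), IsPolynomialMap f ∧ g = fun t v => t ^ m • f v}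

variable {V W}

theorem IsPolynomialMap.mem_polynomialCurves {f : V → W} (hf : IsPolynomialMap f) :
    (fun _ v => f v) ∈ polynomialCurves V W :=
  Submodule.subset_span ⟨0, f, hf, by simp⟩

theorem polynomialCurves.isPolynomialMap {g : ℝ → V → W} (hg : g ∈ polynomialCurves V W) (t : ℝ) :
    IsPolynomialMap (g t) := by
  induction hg using Submodule.span_induction with
  | mem x hx =>
    obtain ⟨m, f, hf, rfl⟩ := hx
    exact hf.const_smul _
  | zero => exact IsPolynomialMap.const 0
  | add x y _ _ hx hy => exact hx.add hy
  | smul c x _ hx => exact hx.const_smul c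

theorem polynomialCurves.continuous {g : ℝ → V → W} (hg : g ∈ polynomialCurves V W) (v : V) :
    Continuous (fun t => g t v) := by
  induction hg using Submodule.span_induction with
  | mem x hx =>
    obtain ⟨m, f, hf, rfl⟩ := hx
    fun_prop
  | zero => exact continuous_const
  | add x y _ _ hx hy => exact hx.add hy
  | smul c x _ hx => exact hx.const_smul c

theorem polynomialCurves.integral [CompleteSpace W] {g : ℝ → V → W}
    (hg : g ∈ polynomialCurves V W) :
    (fun t v => ∫ s in (0 : ℝ)..t, g s v) ∈ polynomialCurves V W := by
  induction hg using Submodule.span_induction with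
  | mem x hx =>
    obtain ⟨m, f, hf, rfl⟩ := hx
    refine Submodule.subset_span ⟨m + 1, fun v => ((m : ℝ) + 1)⁻¹ • f v, hf.const_smul _, ?_⟩
    funext t v
    rw [intervalIntegral.integral_smul_const, integral_pow, smul_smul]
    simp [div_eq_mul_inv]
  | zero =>
    convert (polynomialCurves V W).zero_mem using 1
    funext t v
    simp
  | add x y hx hy ihx ihy =>
    convert (polynomialCurves V W).add_mem ihx ihy using 1
    funext t v
    exact intervalIntegral.integral_add ((continuous hx v).intervalIntegrable _ _)
      ((continuous hy v).intervalIntegrable _ _)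
  | smul c x _ hx =>
    convert (polynomialCurves V W).smul_mem c hx using 1
    funext t v
    exact intervalIntegral.integral_smul c _

theorem polynomialCurves.bilinear {W₁ W₂ : Type*} [NormedAddCommGroup W₁] [NormedSpace ℝ W₁]
    [NormedAddCommGroup W₂] [NormedSpace ℝ W₂] [FiniteDimensional ℝ W₁]
    (b : W₁ →ₗ[ℝ] W₂ →ₗ[ℝ] W) {g : ℝ → V → W₁} {h : ℝ → V → W₂}
    (hg : g ∈ polynomialCurves V W₁) (hh : h ∈ polynomialCurves V W₂) :
    (fun t v => b (g t v) (h t v)) ∈ polynomialCurves V W := by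
  induction hg using Submodule.span_induction with
  | mem x hx =>
    obtain ⟨m, f, hf, rfl⟩ := hx
    induction hh using Submodule.span_induction with
    | mem y hy =>
      obtain ⟨k, f', hf', rfl⟩ := hy
      refine Submodule.subset_span ⟨m + k, _, IsPolynomialMap.bilinear b hf hf', ?_⟩
      funext t v
      simp [smul_smul, pow_add, mul_comm]
    | zero =>
      convert (polynomialCurves V W).zero_mem using 1
      funext t v
      simp
    | add y z _ _ hy hz => simpa only [Pi.add_apply, map_add] using! Submodule.add_mem _ hy hz
    | smul c y _ hy => simpa only [Pi.smul_apply, map_smul] using! Submodule.smul_mem _ c hy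
  | zero =>
    convert (polynomialCurves V W).zero_mem using 1
    funext t v
    simp
  | add x y _ _ hx hy =>
    simpa only [Pi.add_apply, map_add, LinearMap.add_apply] using! Submodule.add_mem _ hx hy
  | smul c x _ hx =>
    simpa only [Pi.smul_apply, map_smul, LinearMap.smul_apply] using! Submodule.smul_mem _ c hx

end PolynomialCurves

/-! ### Nilpotent brackets and the operator `(1 - exp (-ad x)) / ad x` -/

section NilpotentBracket

open Polynomial

variable {E : Type*} [NormedAddCommGroup E] [NormedSpace ℝ E]

/-- The bracket `β` of a nilpotent Lie algebra together with a descending filtration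
`E = F 0 ⊇ F 1 ⊇ ⋯ ⊇ F n = 0` such that `β x` maps `F i` into `F (i + 1)`. Only
antisymmetry and compatibility with the filtration are recorded. -/
structure IsNilpotentBracket (β : E →L[ℝ] E →L[ℝ] E) (F : ℕ → Submodule ℝ E) (n : ℕ) : Prop where
  top : F 0 = ⊤
  bot : F n = ⊥
  anti : Antitone F
  self : ∀ x, β x x = 0
  mem_succ : ∀ i x, ∀ y ∈ F i, β x y ∈ F (i + 1)

/-- The polynomial `∑_{k < n} (-1)^k / (k + 1)! T ^ k`, a truncation of `(1 - exp (-T)) / T`. -/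
noncomputable def dexpPoly (n : ℕ) : ℝ[X] :=
  ∑ k ∈ Finset.range n, C ((-1) ^ k / ((k + 1).factorial : ℝ)) * X ^ k

theorem coeff_dexpPoly (n j : ℕ) :
    (dexpPoly n).coeff j = if j < n then (-1) ^ j / ((j + 1).factorial : ℝ) else 0 := by
  simp [dexpPoly, coeff_C_mul, coeff_X_pow]

/-- As its constant coefficient is `1`, `dexpPoly n` is invertible modulo `T ^ n`. -/
theorem exists_dexpPoly_inverse {n : ℕ} (hn : 1 ≤ n) :
    ∃ u v : ℝ[X], u * dexpPoly n + v * X ^ n = 1 := by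
  have h : IsCoprime (dexpPoly n) X := by
    refine ⟨1, -(dexpPoly n).divX, ?_⟩
    have h0 : (dexpPoly n).coeff 0 = 1 := by simp [coeff_dexpPoly, show n ≠ 0 by omega]
    have := divX_mul_X_add (dexpPoly n)
    rw [h0, map_one] at this
    linear_combination -this
  exact h.pow_right

/-- A polynomial inverse of `dexpPoly n` modulo `T ^ n`, which agrees with `T / (1 - exp (-T))` up
to that order. The value for `n = 0` is arbitrary. -/
noncomputable def dexpInvPoly (n : ℕ) : ℝ[X] :=
  if h : 1 ≤ n then (exists_dexpPoly_inverse h).choose else 1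

theorem dexpInvPoly_spec {n : ℕ} (hn : 1 ≤ n) :
    ∃ v : ℝ[X], dexpInvPoly n * dexpPoly n + v * X ^ n = 1 := by
  rw [dexpInvPoly, dif_pos hn]
  exact (exists_dexpPoly_inverse hn).choose_spec

theorem coeff_zero_dexpInvPoly {n : ℕ} (hn : 1 ≤ n) : (dexpInvPoly n).coeff 0 = 1 := by
  obtain ⟨v, hv⟩ := dexpInvPoly_spec hn
  have := congrArg (fun p => coeff p 0) hv
  simpa [mul_coeff_zero, coeff_dexpPoly, show 0 < n by omega, show 0 ≠ n by omega] using this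

theorem coeff_one_dexpInvPoly {n : ℕ} (hn : 2 ≤ n) : (dexpInvPoly n).coeff 1 = 1 / 2 := by
  obtain ⟨v, hv⟩ := dexpInvPoly_spec (show 1 ≤ n by omega)
  have := congrArg (fun p => coeff p 1) hv
  simp only [coeff_add, mul_coeff_one, coeff_dexpPoly, coeff_X_pow,
    coeff_zero_dexpInvPoly (show 1 ≤ n by omega), coeff_one, show 0 < n by omega,
    show 1 < n by omega, show 0 ≠ n by omega, show 1 ≠ n by omega, if_true, if_false] at this
  norm_num at this
  linarith

/-- The operator `(1 - exp (-ad x)) / ad x`, which will be the left-trivialised derivative of the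
exponential map at `x`. It is given by a truncated series, which is exact when `(β x) ^ n = 0`. -/
noncomputable def dexp (β : E →L[ℝ] E →L[ℝ] E) (n : ℕ) (x : E) : E →L[ℝ] E :=
  aeval (β x) (dexpPoly n)

/-- The inverse operator `ad x / (1 - exp (-ad x))`. -/
noncomputable def dexpInv (β : E →L[ℝ] E →L[ℝ] E) (n : ℕ) (x : E) : E →L[ℝ] E :=
  aeval (β x) (dexpInvPoly n)

theorem dexp_apply (β : E →L[ℝ] E →L[ℝ] E) (n : ℕ) (x y : E) :
    dexp β n x y =
      ∑ k ∈ Finset.range n, ((-1) ^ k / ((k + 1).factorial : ℝ)) • ((β x) ^ k) y := by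
  simp [dexp, dexpPoly, Algebra.algebraMap_eq_smul_one]

theorem dexpInv_apply (β : E →L[ℝ] E →L[ℝ] E) (n : ℕ) (x y : E) :
    dexpInv β n x y = ∑ k ∈ Finset.range ((dexpInvPoly n).natDegree + 1),
      (dexpInvPoly n).coeff k • ((β x) ^ k) y := by
  simp [dexpInv, aeval_eq_sum_range]

theorem dexpInv_eq_self {β : E →L[ℝ] E →L[ℝ] E} {n : ℕ} (hn : 1 ≤ n) {x y : E} (hxy : β x y = 0) :
    dexpInv β n x y = y := by
  rw [dexpInv_apply, Finset.sum_range_succ', coeff_zero_dexpInvPoly hn]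
  simp [pow_succ, hxy]

theorem contDiff_dexp (β : E →L[ℝ] E →L[ℝ] E) (n : ℕ) : ContDiff ℝ ∞ (dexp β n) := by
  have : dexp β n = fun x => ∑ k ∈ Finset.range n,
      ((-1) ^ k / ((k + 1).factorial : ℝ)) • (β x) ^ k := by
    funext x
    ext y
    simp [dexp_apply]
  rw [this]
  exact ContDiff.sum fun k _ => (β.contDiff.pow k).const_smul _

namespace IsNilpotentBracket

variable {β : E →L[ℝ] E →L[ℝ] E} {F : ℕ → Submodule ℝ E} {n : ℕ}

theorem swap (h : IsNilpotentBracket β F n) (x y : E) : β x y = -β y x := by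
  have := h.self (x + y)
  simp only [map_add, add_apply, h.self, zero_add, add_zero] at this
  exact eq_neg_of_add_eq_zero_right this

theorem mem_succ_left (h : IsNilpotentBracket β F n) {i : ℕ} {x : E} (hx : x ∈ F i) (y : E) :
    β x y ∈ F (i + 1) := by
  rw [h.swap]
  exact Submodule.neg_mem _ (h.mem_succ i y x hx)

theorem pow_mem (h : IsNilpotentBracket β F n) (x y : E) (k : ℕ) : ((β x) ^ k) y ∈ F k := by
  induction k with
  | zero => simp [h.top]
  | succ k ih =>
    rw [pow_succ']
    exact h.mem_succ k x _ ih

theorem eq_bot_of_le (h : IsNilpotentBracket β F n) {k : ℕ} (hk : n ≤ k) : F k = ⊥ :=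
  eq_bot_iff.2 (h.bot ▸ h.anti hk)

theorem pow_eq_zero (h : IsNilpotentBracket β F n) (x : E) : (β x) ^ n = 0 := by
  ext y
  simpa [h.bot] using h.pow_mem x y n

theorem dexpInv_mul_dexp (h : IsNilpotentBracket β F n) (hn : 1 ≤ n) (x : E) :
    dexpInv β n x * dexp β n x = 1 := by
  obtain ⟨v, hv⟩ := dexpInvPoly_spec hn
  have := congrArg (aeval (β x)) hv
  simpa [h.pow_eq_zero, dexp, dexpInv] using this

theorem dexp_mul_dexpInv (h : IsNilpotentBracket β F n) (hn : 1 ≤ n) (x : E) :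
    dexp β n x * dexpInv β n x = 1 := by
  rw [← h.dexpInv_mul_dexp hn x]
  simp only [dexp, dexpInv, ← map_mul, mul_comm]

/-- The left-trivialised derivative of the exponential map at `x` is invertible. -/
noncomputable def dexpEquiv (h : IsNilpotentBracket β F n) (hn : 1 ≤ n) (x : E) : E ≃L[ℝ] E :=
  ContinuousLinearEquiv.equivOfInverse (dexp β n x) (dexpInv β n x)
    (fun y => by simpa using congrArg (fun A : E →L[ℝ] E => A y) (h.dexpInv_mul_dexp hn x))
    (fun y => by simpa using congrArg (fun A : E →L[ℝ] E => A y) (h.dexp_mul_dexpInv hn x))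

theorem coe_dexpEquiv (h : IsNilpotentBracket β F n) (hn : 1 ≤ n) (x : E) :
    (h.dexpEquiv hn x : E →L[ℝ] E) = dexp β n x := by
  ext y
  rfl

theorem dexp_dexpInv (h : IsNilpotentBracket β F n) (hn : 1 ≤ n) (x y : E) :
    dexp β n x (dexpInv β n x y) = y :=
  congrArg (fun A : E →L[ℝ] E => A y) (h.dexp_mul_dexpInv hn x)

/-- `dexpInv β n x y` depends on `x` only through terms one step deeper in the filtration. -/
theorem dexpInv_sub_mem (h : IsNilpotentBracket β F n) (hn : 1 ≤ n) {i : ℕ} {x x' y y' : E}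
    (hx : x' - x ∈ F i) (hy : y' - y ∈ F i) :
    dexpInv β n x' y' - dexpInv β n x y - (y' - y) ∈ F (i + 1) := by
  have hstep : ∀ k, (β x' ^ (k + 1)) y' - (β x ^ (k + 1)) y ∈ F (i + 1) := by
    have hgen : ∀ w w' : E, w' - w ∈ F i → β x' w' - β x w ∈ F (i + 1) := by
      intro w w' hw
      have : β x' w' - β x w = β (x' - x) w' + β x (w' - w) := by simp
      rw [this]
      exact Submodule.add_mem _ (h.mem_succ_left hx _) (h.mem_succ i _ _ hw)
    intro k
    induction k with
    | zero => simpa using hgen y y' hy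
    | succ k ih =>
      rw [pow_succ' _ (k + 1), pow_succ' _ (k + 1)]
      exact hgen _ _ (h.anti (Nat.le_succ i) ih)
  rw [dexpInv_apply, dexpInv_apply, Finset.sum_range_succ', Finset.sum_range_succ',
    coeff_zero_dexpInvPoly hn]
  simp only [pow_zero, one_smul, one_apply_eq_self]
  rw [add_sub_add_comm, add_sub_cancel_right, ← Finset.sum_sub_distrib]
  refine Submodule.sum_mem _ fun k _ => ?_
  rw [← smul_sub]
  exact Submodule.smul_mem _ _ (hstep k)

theorem dexpInv_two (h : IsNilpotentBracket β F 2) (x y : E) :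
    dexpInv β 2 x y = y + (1 / 2 : ℝ) • β x y := by
  have hk : ∀ k, 2 ≤ k → (β x ^ k) y = 0 := fun k hk => by
    simpa [h.eq_bot_of_le hk] using h.pow_mem x y k
  have h1 : (dexpInvPoly 2).natDegree + 1 = (dexpInvPoly 2).natDegree - 1 + 2 := by
    have : 1 ≤ (dexpInvPoly 2).natDegree := le_natDegree_of_ne_zero (by
      rw [coeff_one_dexpInvPoly le_rfl]; norm_num)
    omega
  rw [dexpInv_apply, h1, Finset.sum_range_succ', Finset.sum_range_succ',
    coeff_zero_dexpInvPoly (by norm_num), Finset.sum_eq_zero fun k _ => by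
      rw [hk _ (by omega), smul_zero]]
  simp [coeff_one_dexpInvPoly, add_comm]

end IsNilpotentBracket

end NilpotentBracket

/-! ### The Campbell–Hausdorff flow -/

section BchFlow

variable {E : Type*} [NormedAddCommGroup E] [NormedSpace ℝ E] [FiniteDimensional ℝ E]

/-- A curve whose velocity stays in a subspace and which starts in it remains in it. -/
theorem Submodule.mem_of_hasDerivAt_mem (S : Submodule ℝ E) {c c' : ℝ → E}
    (hc : ∀ t, HasDerivAt c (c' t) t) (hc' : ∀ t, c' t ∈ S) (h0 : c 0 ∈ S) (t : ℝ) : c t ∈ S := by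
  rw [← Subspace.forall_mem_dualAnnihilator_apply_eq_zero_iff S]
  intro φ hφ
  rw [Submodule.mem_dualAnnihilator] at hφ
  have hd : ∀ s, HasDerivAt (fun s => φ (c s)) 0 s := fun s => by
    have := (LinearMap.toContinuousLinearMap φ).hasFDerivAt.comp_hasDerivAt s (hc s)
    simpa [hφ _ (hc' s), Function.comp_def] using this
  have := is_const_of_deriv_eq_zero (fun s => (hd s).differentiableAt) (fun s => (hd s).deriv) t 0
  rw [this, hφ _ h0]

/-- The Picard iterates of the equation `c' = dexpInv (c) y`, `c 0 = x`, as functions of the time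
and of the pair `(x, y)`. -/
noncomputable def bchPicard (β : E →L[ℝ] E →L[ℝ] E) (n : ℕ) : ℕ → ℝ → E × E → E
  | 0 => fun _ v => v.1
  | j + 1 => fun t v => v.1 + ∫ s in (0 : ℝ)..t, dexpInv β n (bchPicard β n j s v) v.2

/-- The solution at time `t` of `c' = dexpInv (c) y`, `c 0 = x`; the exponential map will turn it
into the curve `exp x * exp (t • y)`. The Picard iteration becomes stationary after `n` steps. -/
noncomputable def bchFlow (β : E →L[ℝ] E →L[ℝ] E) (n : ℕ) : ℝ → E × E → E := bchPicard β n n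

/-- The Campbell–Hausdorff product of a nilpotent Lie algebra. -/
noncomputable def bchMul (β : E →L[ℝ] E →L[ℝ] E) (n : ℕ) (x y : E) : E := bchFlow β n 1 (x, y)

theorem dexpInv_mem_polynomialCurves (β : E →L[ℝ] E →L[ℝ] E) (n : ℕ) {g : ℝ → E × E → E}
    (hg : g ∈ polynomialCurves (E × E) E) :
    (fun t v => dexpInv β n (g t v) v.2) ∈ polynomialCurves (E × E) E := by
  have hpow : ∀ k, (fun t v => (β (g t v) ^ k) v.2) ∈ polynomialCurves (E × E) E := by
    intro k
    induction k with
    | zero => exact (IsPolynomialMap.of_linear (LinearMap.snd ℝ E E)).mem_polynomialCurves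
    | succ k ih =>
      simp only [pow_succ']
      exact polynomialCurves.bilinear (ContinuousLinearMap.coeLM ℝ ∘ₗ β.toLinearMap) hg ih
  simp only [dexpInv_apply]
  convert Submodule.sum_mem (polynomialCurves (E × E) E)
    (t := Finset.range ((dexpInvPoly n).natDegree + 1))
    (f := fun k => (dexpInvPoly n).coeff k • fun t v => (β (g t v) ^ k) v.2)
    (fun k _ => Submodule.smul_mem _ _ (hpow k)) using 1
  funext t v
  simp

theorem bchPicard_mem_polynomialCurves (β : E →L[ℝ] E →L[ℝ] E) (n j : ℕ) :
    bchPicard β n j ∈ polynomialCurves (E × E) E := by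
  have h1 := (IsPolynomialMap.of_linear (LinearMap.fst ℝ E E)).mem_polynomialCurves
  induction j with
  | zero => exact h1
  | succ j ih =>
    exact Submodule.add_mem _ h1
      (polynomialCurves.integral (dexpInv_mem_polynomialCurves β n ih))

theorem hasDerivAt_bchPicard_succ (β : E →L[ℝ] E →L[ℝ] E) (n j : ℕ) (v : E × E) (t : ℝ) :
    HasDerivAt (fun t => bchPicard β n (j + 1) t v)
      (dexpInv β n (bchPicard β n j t v) v.2) t := by
  have hc := polynomialCurves.continuous
    (dexpInv_mem_polynomialCurves β n (bchPicard_mem_polynomialCurves β n j)) v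
  exact (intervalIntegral.integral_hasDerivAt_right (hc.intervalIntegrable _ _)
    hc.aestronglyMeasurable.stronglyMeasurableAtFilter hc.continuousAt).const_add _

omit [FiniteDimensional ℝ E] in
theorem bchPicard_zero_time (β : E →L[ℝ] E →L[ℝ] E) (n j : ℕ) (v : E × E) :
    bchPicard β n j 0 v = v.1 := by
  cases j <;> simp [bchPicard]

omit [FiniteDimensional ℝ E] in
theorem bchFlow_zero_time (β : E →L[ℝ] E →L[ℝ] E) (n : ℕ) (v : E × E) : bchFlow β n 0 v = v.1 :=
  bchPicard_zero_time β n n v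

theorem isPolynomialMap_bchMul (β : E →L[ℝ] E →L[ℝ] E) (n : ℕ) :
    IsPolynomialMap (fun v : E × E => bchMul β n v.1 v.2) :=
  polynomialCurves.isPolynomialMap (bchPicard_mem_polynomialCurves β n n) 1

theorem continuous_bchMul (β : E →L[ℝ] E →L[ℝ] E) (n : ℕ) :
    Continuous (fun v : E × E => bchMul β n v.1 v.2) :=
  (isPolynomialMap_bchMul β n).continuous

namespace IsNilpotentBracket

variable {β : E →L[ℝ] E →L[ℝ] E} {F : ℕ → Submodule ℝ E} {n : ℕ}

/-- Each Picard iteration gains one step of the filtration. -/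
theorem bchPicard_succ_sub_mem (h : IsNilpotentBracket β F n) (hn : 1 ≤ n) (v : E × E) (j : ℕ) :
    ∀ t, bchPicard β n (j + 1) t v - bchPicard β n j t v ∈ F j := by
  induction j with
  | zero => simp [h.top]
  | succ j ih =>
    refine Submodule.mem_of_hasDerivAt_mem _
      (fun t => (hasDerivAt_bchPicard_succ β n (j + 1) v t).sub
        (hasDerivAt_bchPicard_succ β n j v t))
      (fun t => ?_) (by simp [bchPicard_zero_time])
    simpa using h.dexpInv_sub_mem hn (y := v.2) (y' := v.2) (ih t) (by simp)

theorem hasDerivAt_bchFlow (h : IsNilpotentBracket β F n) (hn : 1 ≤ n) (v : E × E) (t : ℝ) :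
    HasDerivAt (fun t => bchFlow β n t v) (dexpInv β n (bchFlow β n t v) v.2) t := by
  -- `F n = 0`, so the iteration is stationary from step `n` on
  have heq : ∀ t, bchPicard β n (n + 1) t v = bchFlow β n t v := fun t => by
    have := h.bchPicard_succ_sub_mem hn v n t
    rwa [h.bot, Submodule.mem_bot, sub_eq_zero] at this
  have := hasDerivAt_bchPicard_succ β n n v t
  simpa only [heq] using! this

/-- Two solutions of `c' = dexpInv (c) y` whose data agree modulo `F k` differ, modulo the deeper
term `F (k + 1)`, as they would for a commutative bracket. -/
theorem solution_sub_mem (h : IsNilpotentBracket β F n) (hn : 1 ≤ n) {c c' : ℝ → E} {y y' : E}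
    (hc : ∀ t, HasDerivAt c (dexpInv β n (c t) y) t)
    (hc' : ∀ t, HasDerivAt c' (dexpInv β n (c' t) y') t) {k : ℕ}
    (h0 : c' 0 - c 0 ∈ F k) (hy : y' - y ∈ F k) (t : ℝ) :
    c' t - c t - (c' 0 - c 0) - t • (y' - y) ∈ F (k + 1) := by
  have hmem : ∀ j ≤ k, ∀ t, c' t - c t ∈ F j := by
    intro j hj
    induction j with
    | zero => simp [h.top]
    | succ j ih =>
      refine Submodule.mem_of_hasDerivAt_mem _ (fun t => (hc' t).sub (hc t)) (fun t => ?_)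
        (h.anti hj h0)
      have h1 := h.dexpInv_sub_mem hn (ih (by omega) t) (h.anti (show j ≤ k by omega) hy)
      simpa using Submodule.add_mem _ h1 (h.anti hj hy)
  refine Submodule.mem_of_hasDerivAt_mem (F (k + 1))
    (c := fun t => c' t - c t - (c' 0 - c 0) - t • (y' - y))
    (fun t => (((hc' t).sub (hc t)).sub_const _).sub ((hasDerivAt_id t).smul_const (y' - y)))
    (fun t => ?_) (by simp) t
  simpa using h.dexpInv_sub_mem hn (hmem k le_rfl t) hy

theorem solution_eq (h : IsNilpotentBracket β F n) (hn : 1 ≤ n) {c c' : ℝ → E} {y : E}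
    (hc : ∀ t, HasDerivAt c (dexpInv β n (c t) y) t)
    (hc' : ∀ t, HasDerivAt c' (dexpInv β n (c' t) y) t) (h0 : c' 0 = c 0) : c' = c := by
  funext t
  have := h.solution_sub_mem hn hc hc' (k := n) (by simp [h0]) (by simp) t
  rw [h.eq_bot_of_le (Nat.le_succ n)] at this
  simpa [h0, sub_eq_zero] using this

/-- Modulo `F (k + 1)`, the correction term of the Campbell–Hausdorff product depends only on the
arguments modulo `F k`. -/
theorem bchMul_sub_mem (h : IsNilpotentBracket β F n) (hn : 1 ≤ n) {k : ℕ} {x x' y y' : E}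
    (hx : x' - x ∈ F k) (hy : y' - y ∈ F k) :
    (bchMul β n x' y' - x' - y') - (bchMul β n x y - x - y) ∈ F (k + 1) := by
  have := h.solution_sub_mem hn (h.hasDerivAt_bchFlow hn (x, y)) (h.hasDerivAt_bchFlow hn (x', y'))
    (k := k) (by simpa [bchFlow_zero_time] using hx) hy 1
  simp only [bchFlow_zero_time, one_smul] at this
  convert this using 1
  simp only [bchMul]
  abel

theorem bchMul_zero (h : IsNilpotentBracket β F n) (hn : 1 ≤ n) (x : E) : bchMul β n x 0 = x :=
  congrFun (h.solution_eq hn (c := fun _ => x) (y := 0)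
    (fun t => by simpa using hasDerivAt_const t x)
    (h.hasDerivAt_bchFlow hn (x, 0)) (bchFlow_zero_time β n _)) 1

theorem zero_bchMul (h : IsNilpotentBracket β F n) (hn : 1 ≤ n) (y : E) : bchMul β n 0 y = y := by
  have := congrFun (h.solution_eq hn (c := fun t => t • y) (y := y) (fun t => by
    rw [dexpInv_eq_self hn (by simp [h.self])]
    simpa using (hasDerivAt_id t).smul_const y)
    (h.hasDerivAt_bchFlow hn (0, y)) (by simp [bchFlow_zero_time])) 1
  simpa [bchMul] using this

theorem bchMul_two {F : ℕ → Submodule ℝ E} (h : IsNilpotentBracket β F 2) (x y : E) :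
    bchMul β 2 x y = x + y + (1 / 2 : ℝ) • β x y := by
  have hββ : β (β x y) y = 0 := by
    have := h.mem_succ_left (h.mem_succ 0 x y (by simp [h.top])) y
    simpa [h.bot] using this
  have := congrFun (h.solution_eq one_le_two
    (c := fun t => x + t • (y + (1 / 2 : ℝ) • β x y)) (y := y) (fun t => by
      rw [h.dexpInv_two]
      simpa [h.self, hββ] using
        ((hasDerivAt_id t).smul_const (y + (1 / 2 : ℝ) • β x y)).const_add x)
    (h.hasDerivAt_bchFlow one_le_two (x, y)) (by simp [bchFlow_zero_time])) 1
  simpa [bchMul, add_assoc] using this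

end IsNilpotentBracket

end BchFlow

/-! ### Linearisation of the equation for the derivative of the exponential map -/

section DexpEstimate

open Set

variable {E : Type*} [NormedAddCommGroup E] [NormedSpace ℝ E]
  {β : E →L[ℝ] E →L[ℝ] E} {F : ℕ → Submodule ℝ E} {n : ℕ}

/-- The solution of the linear equation `b' = y - β x b`, `b 0 = 0`, whose value at time `1` is
`dexp β n x y`. -/
noncomputable def dexpCurve (β : E →L[ℝ] E →L[ℝ] E) (n : ℕ) (x y : E) (t : ℝ) : E :=
  ∑ k ∈ Finset.range n, (t ^ (k + 1) * ((-1) ^ k / ((k + 1).factorial : ℝ))) • ((β x) ^ k) y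

theorem IsNilpotentBracket.hasDerivAt_dexpCurve (h : IsNilpotentBracket β F n) (hn : 1 ≤ n)
    (x y : E) (t : ℝ) :
    HasDerivAt (dexpCurve β n x y) (y - β x (dexpCurve β n x y t)) t := by
  -- the derivative of the truncated series is the same series shifted by one power of `β x`; the
  -- boundary term vanishes because `(β x) ^ n = 0`
  have hd : HasDerivAt (dexpCurve β n x y) (∑ k ∈ Finset.range n,
      (t ^ k * ((-1) ^ k / (k.factorial : ℝ))) • ((β x) ^ k) y) t := by
    refine HasDerivAt.fun_sum fun k _ => ?_
    have h1 := (((hasDerivAt_pow (k + 1) t).mul_const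
      ((-1) ^ k / ((k + 1).factorial : ℝ))).smul_const (((β x) ^ k) y))
    convert h1 using 2
    rw [Nat.factorial_succ]
    push_cast
    have : (k.factorial : ℝ) ≠ 0 := by positivity
    field_simp
  convert hd using 1
  obtain ⟨m, rfl⟩ : ∃ m, n = m + 1 := ⟨n - 1, by omega⟩
  rw [Finset.sum_range_succ', dexpCurve, Finset.sum_range_succ]
  have hz : β x (((β x) ^ m) y) = 0 := by
    have := congrArg (fun A : E →L[ℝ] E => A y) (h.pow_eq_zero x)
    simpa [pow_succ'] using this
  simp only [map_add, map_sum, map_smul, hz, smul_zero, add_zero]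
  rw [sub_eq_add_neg, ← Finset.sum_neg_distrib, add_comm]
  congr 1
  · refine Finset.sum_congr rfl fun k _ => ?_
    rw [pow_succ' (β x), ← neg_smul]
    simp only [mul_apply_eq_comp]
    congr 1
    ring
  · simp

theorem dexpCurve_zero (x y : E) : dexpCurve β n x y 0 = 0 := by simp [dexpCurve]

theorem dexpCurve_one (x y : E) : dexpCurve β n x y 1 = dexp β n x y := by
  simp [dexpCurve, dexp_apply]

/-- Comparison of a nonlinear equation `u' = K (u) x + C (u) y` with its linearisation
`b' = β b x + y` at the origin, for small `y`: the solution is of size `O(y)`, and differs from the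
solution of the linearised equation by `o(y)`. The a priori bound, valid on every interval on which
`u` is small, is what excludes that `u` leaves a given neighbourhood of the origin. -/
theorem IsNilpotentBracket.dexp_estimate (h : IsNilpotentBracket β F n) (hn : 1 ≤ n)
    {K C : E → E →L[ℝ] E} (hK0 : K 0 = 0) (hK : HasFDerivAt K β 0) (hC : ContinuousAt C 0)
    (hC0 : C 0 = 1) (x : E) :
    ∃ M : ℝ, 0 ≤ M ∧ ∀ ε > 0, ∃ r > 0, ∀ (y : E) (u : ℝ → E) (T : ℝ), T ≤ 1 →
      u 0 = 0 → ContinuousOn u (Icc 0 T) →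
      (∀ t ∈ Ico 0 T, ‖u t‖ ≤ r ∧ HasDerivAt u (K (u t) x + C (u t) y) t) →
      (∀ t ∈ Icc 0 T, ‖u t‖ ≤ M * ‖y‖) ∧ (T = 1 → ‖u 1 - dexp β n x y‖ ≤ ε * ‖y‖) := by
  -- Gronwall constants: `k₁` for `u` itself, `k₂` for its distance to the linearised solution
  set k₁ : ℝ := (‖β‖ + 1) * ‖x‖ + 1 with hk₁
  have hk₁pos : 0 < k₁ := by positivity
  set M : ℝ := 2 / k₁ * (Real.exp k₁ - 1) with hM
  have hexp : ∀ k : ℝ, 0 < k → 0 ≤ Real.exp k - 1 := fun k hk => by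
    linarith [Real.add_one_le_exp k]
  have hM0 : 0 ≤ M := mul_nonneg (by positivity) (hexp _ hk₁pos)
  refine ⟨M, hM0, fun ε hε => ?_⟩
  set k₂ : ℝ := ‖β‖ * ‖x‖ + 1 with hk₂
  have hk₂pos : 0 < k₂ := by positivity
  set A : ℝ := (M * ‖x‖ + 1) / k₂ * (Real.exp k₂ - 1) with hA
  have hA0 : 0 ≤ A := mul_nonneg (by positivity) (hexp _ hk₂pos)
  obtain ⟨η, hη0, hη1, hηA⟩ : ∃ η : ℝ, 0 < η ∧ η ≤ 1 ∧ η * A ≤ ε := by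
    refine ⟨min 1 (ε / (A + 1)), by positivity, min_le_left _ _, ?_⟩
    calc min 1 (ε / (A + 1)) * A ≤ ε / (A + 1) * (A + 1) := by
          gcongr
          · exact min_le_right _ _
          · linarith
      _ = ε := by field_simp
  have hKe : ∀ᶠ u in nhds (0 : E), ‖K u - β u‖ ≤ η * ‖u‖ := by
    have := (hasFDerivAt_iff_isLittleO_nhds_zero.1 hK).def hη0
    simpa [hK0] using this
  have hCe : ∀ᶠ u in nhds (0 : E), ‖C u - 1‖ ≤ η := by
    have := Metric.continuousAt_iff'.1 hC η hη0
    filter_upwards [this] with u hu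
    rw [hC0, dist_eq_norm] at hu
    exact hu.le
  obtain ⟨r, hr, hrball⟩ := Metric.eventually_nhds_iff_ball.1 (hKe.and hCe)
  refine ⟨r / 2, by positivity, fun y u T hT h0 hcont hu => ?_⟩
  have hsmall : ∀ t ∈ Ico 0 T, ‖K (u t) - β (u t)‖ ≤ η * ‖u t‖ ∧ ‖C (u t) - 1‖ ≤ η := fun t ht =>
    hrball _ (by simpa using lt_of_le_of_lt (hu t ht).1 (by linarith))
  have hbound : ∀ t ∈ Icc 0 T, ‖u t‖ ≤ M * ‖y‖ := by
    intro t ht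
    have hg := norm_le_gronwallBound_of_norm_deriv_right_le (δ := 0) (K := k₁) (ε := 2 * ‖y‖) hcont
      (fun s hs => (hu s hs).2.hasDerivWithinAt) (by simp [h0]) (fun s hs => ?_) t ht
    · refine hg.trans ?_
      rw [gronwallBound_of_K_ne_0 hk₁pos.ne', hM]
      simp only [sub_zero, zero_mul, zero_add]
      calc 2 * ‖y‖ / k₁ * (Real.exp (k₁ * t) - 1) ≤ 2 * ‖y‖ / k₁ * (Real.exp k₁ - 1) := by
            gcongr
            nlinarith [ht.2]
        _ = 2 / k₁ * (Real.exp k₁ - 1) * ‖y‖ := by ring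
    · obtain ⟨h1, h2⟩ := hsmall s hs
      have hKn : ‖K (u s)‖ ≤ (‖β‖ + 1) * ‖u s‖ := by
        calc ‖K (u s)‖ = ‖(K (u s) - β (u s)) + β (u s)‖ := by rw [sub_add_cancel]
          _ ≤ η * ‖u s‖ + ‖β‖ * ‖u s‖ := (norm_add_le _ _).trans (add_le_add h1 (β.le_opNorm _))
          _ ≤ (‖β‖ + 1) * ‖u s‖ := by nlinarith [norm_nonneg (u s)]
      have hCn : ‖C (u s) y‖ ≤ 2 * ‖y‖ := by
        calc ‖C (u s) y‖ = ‖(C (u s) - 1) y + y‖ := by simp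
          _ ≤ η * ‖y‖ + ‖y‖ := (norm_add_le _ _).trans
              (add_le_add (((C (u s) - 1).le_opNorm y).trans (by gcongr)) le_rfl)
          _ ≤ 2 * ‖y‖ := by nlinarith [norm_nonneg y]
      calc ‖K (u s) x + C (u s) y‖ ≤ (‖β‖ + 1) * ‖u s‖ * ‖x‖ + 2 * ‖y‖ :=
            (norm_add_le _ _).trans (add_le_add (((K (u s)).le_opNorm x).trans (by gcongr)) hCn)
        _ ≤ k₁ * ‖u s‖ + 2 * ‖y‖ := by rw [hk₁]; nlinarith [norm_nonneg (u s)]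
  refine ⟨hbound, ?_⟩
  rintro rfl
  have hd : ∀ s ∈ Ico (0 : ℝ) 1, HasDerivAt (fun s => u s - dexpCurve β n x y s)
      (K (u s) x + C (u s) y - (y - β x (dexpCurve β n x y s))) s := fun s hs =>
    (hu s hs).2.sub (h.hasDerivAt_dexpCurve hn x y s)
  have hbc : Continuous (dexpCurve β n x y) := by
    unfold dexpCurve
    fun_prop
  have hg := norm_le_gronwallBound_of_norm_deriv_right_le
    (f := fun s => u s - dexpCurve β n x y s) (δ := 0) (K := k₂)
    (ε := η * (M * ‖x‖ + 1) * ‖y‖) (hcont.sub hbc.continuousOn)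
    (fun s hs => (hd s hs).hasDerivWithinAt) (by simp [h0, dexpCurve_zero]) (fun s hs => ?_) 1
    (by simp)
  · simp only [dexpCurve_one] at hg
    refine hg.trans ?_
    rw [gronwallBound_of_K_ne_0 hk₂pos.ne']
    simp only [sub_zero, zero_mul, zero_add, mul_one]
    calc η * (M * ‖x‖ + 1) * ‖y‖ / k₂ * (Real.exp k₂ - 1) = η * A * ‖y‖ := by rw [hA]; ring
      _ ≤ ε * ‖y‖ := by gcongr
  · obtain ⟨h1, h2⟩ := hsmall s hs
    have hus := hbound s ⟨hs.1, hs.2.le⟩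
    have hsplit : K (u s) x + C (u s) y - (y - β x (dexpCurve β n x y s)) =
        (K (u s) - β (u s)) x + (C (u s) - 1) y + β (u s - dexpCurve β n x y s) x := by
      rw [h.swap x]
      simp
      abel
    rw [hsplit]
    have e1 : ‖(K (u s) - β (u s)) x‖ ≤ η * (M * ‖y‖) * ‖x‖ :=
      ((K (u s) - β (u s)).le_opNorm x).trans (by gcongr; exact h1.trans (by gcongr))
    have e2 : ‖(C (u s) - 1) y‖ ≤ η * ‖y‖ := ((C (u s) - 1).le_opNorm y).trans (by gcongr)
    have e3 : ‖β (u s - dexpCurve β n x y s) x‖ ≤ ‖β‖ * ‖u s - dexpCurve β n x y s‖ * ‖x‖ :=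
      β.le_opNorm₂ _ _
    refine ((norm_add_le _ _).trans (add_le_add (norm_add_le _ _) le_rfl)).trans ?_
    rw [hk₂]
    nlinarith [norm_nonneg (u s - dexpCurve β n x y s)]

end DexpEstimate

/-! ### The chart at the identity and the local multiplication -/

section IdChart

open Set Filter Topology

variable (E : Type*) [NormedAddCommGroup E] [NormedSpace ℝ E]
  (N : Type*) [TopologicalSpace N] [ChartedSpace E N] [Group N]

/-- The domain of the preferred chart at the identity. -/
def idChartSource : Set N := (extChartAt 𝓘(ℝ, E) (1 : N)).source

variable {N}

/-- The preferred chart at the identity, translated so as to send the identity to `0`. -/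
noncomputable def idChart (g : N) : E :=
  extChartAt 𝓘(ℝ, E) (1 : N) g - extChartAt 𝓘(ℝ, E) (1 : N) 1

variable {E}

/-- The inverse of `idChart`. -/
noncomputable def idChartSymm (N : Type*) [TopologicalSpace N] [ChartedSpace E N] [Group N]
    (x : E) : N :=
  (extChartAt 𝓘(ℝ, E) (1 : N)).symm (x + extChartAt 𝓘(ℝ, E) (1 : N) 1)

/-- The multiplication of the group, read in the chart at the identity. -/
noncomputable def localMul (N : Type*) [TopologicalSpace N] [ChartedSpace E N] [Group N]
    (p : E × E) : E :=
  idChart E (idChartSymm N p.1 * idChartSymm N p.2)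

theorem isOpen_idChartSource : IsOpen (idChartSource E N) := isOpen_extChartAt_source _

theorem one_mem_idChartSource : (1 : N) ∈ idChartSource E N := mem_extChartAt_source _

theorem idChartSource_mem_nhds : idChartSource E N ∈ 𝓝 (1 : N) :=
  isOpen_idChartSource.mem_nhds one_mem_idChartSource

@[simp] theorem idChart_one : idChart E (1 : N) = 0 := by simp [idChart]

@[simp] theorem idChartSymm_zero : idChartSymm N (0 : E) = 1 := by simp [idChartSymm]

theorem idChartSymm_idChart {g : N} (hg : g ∈ idChartSource E N) :
    idChartSymm N (idChart E g) = g := by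
  rw [idChartSymm, idChart, sub_add_cancel]
  exact (extChartAt 𝓘(ℝ, E) (1 : N)).left_inv hg

theorem eventually_idChart_idChartSymm :
    ∀ᶠ x in 𝓝 (0 : E), idChartSymm N x ∈ idChartSource E N ∧
      idChart E (idChartSymm N x) = x ∧
      x + extChartAt 𝓘(ℝ, E) (1 : N) 1 ∈ (extChartAt 𝓘(ℝ, E) (1 : N)).target := by
  have h : ∀ᶠ x in 𝓝 (0 : E),
      x + extChartAt 𝓘(ℝ, E) (1 : N) 1 ∈ (extChartAt 𝓘(ℝ, E) (1 : N)).target := by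
    have hc : Tendsto (fun x : E => x + extChartAt 𝓘(ℝ, E) (1 : N) 1) (𝓝 0)
        (𝓝 (extChartAt 𝓘(ℝ, E) (1 : N) 1)) := by
      have : Continuous (fun x : E => x + extChartAt 𝓘(ℝ, E) (1 : N) 1) := by fun_prop
      simpa using this.tendsto 0
    exact hc.eventually (extChartAt_target_mem_nhds (1 : N))
  filter_upwards [h] with x hx
  exact ⟨(extChartAt 𝓘(ℝ, E) (1 : N)).map_target hx, by
    rw [idChart, idChartSymm, (extChartAt 𝓘(ℝ, E) (1 : N)).right_inv hx, add_sub_cancel_right], hx⟩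

theorem localMul_idChart {g h : N} (hg : g ∈ idChartSource E N) (hh : h ∈ idChartSource E N) :
    localMul N (idChart E g, idChart E h) = idChart E (g * h) := by
  rw [localMul, idChartSymm_idChart hg, idChartSymm_idChart hh]

theorem eventually_localMul_zero_right : ∀ᶠ x in 𝓝 (0 : E), localMul N (x, 0) = x := by
  filter_upwards [eventually_idChart_idChartSymm (N := N)] with x hx
  simp [localMul, hx.2.1]

theorem eventually_localMul_zero_left : ∀ᶠ x in 𝓝 (0 : E), localMul N (0, x) = x := by
  filter_upwards [eventually_idChart_idChartSymm (N := N)] with x hx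
  simp [localMul, hx.2.1]

variable [LieGroup 𝓘(ℝ, E) ∞ N]

theorem contMDiffAt_idChart {g : N} (hg : g ∈ idChartSource E N) :
    ContMDiffAt 𝓘(ℝ, E) 𝓘(ℝ, E) ∞ (idChart E : N → E) g := by
  have h1 : ContMDiffAt 𝓘(ℝ, E) 𝓘(ℝ, E) ∞ (extChartAt 𝓘(ℝ, E) (1 : N)) g :=
    contMDiffAt_extChartAt' (by simpa [idChartSource] using hg)
  have h2 : ContMDiff 𝓘(ℝ, E) 𝓘(ℝ, E) ∞ (fun x : E => x - extChartAt 𝓘(ℝ, E) (1 : N) 1) :=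
    (contDiff_id.sub contDiff_const).contMDiff
  exact h2.contMDiffAt.comp g h1

theorem continuousAt_idChart {g : N} (hg : g ∈ idChartSource E N) :
    ContinuousAt (idChart E : N → E) g := (contMDiffAt_idChart hg).continuousAt

theorem contMDiffAt_idChartSymm {x : E}
    (hx : x + extChartAt 𝓘(ℝ, E) (1 : N) 1 ∈ (extChartAt 𝓘(ℝ, E) (1 : N)).target) :
    ContMDiffAt 𝓘(ℝ, E) 𝓘(ℝ, E) ∞ (idChartSymm N : E → N) x := by
  have h1 := (contMDiffOn_extChartAt_symm (I := 𝓘(ℝ, E)) (n := ∞) (1 : N)).contMDiffAt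
    ((isOpen_extChartAt_target (I := 𝓘(ℝ, E)) (1 : N)).mem_nhds hx)
  have h2 : ContMDiff 𝓘(ℝ, E) 𝓘(ℝ, E) ∞ (fun x : E => x + extChartAt 𝓘(ℝ, E) (1 : N) 1) :=
    (contDiff_id.add contDiff_const).contMDiff
  exact h1.comp x h2.contMDiffAt

theorem contMDiffAt_idChartSymm_zero :
    ContMDiffAt 𝓘(ℝ, E) 𝓘(ℝ, E) ∞ (idChartSymm N : E → N) 0 :=
  contMDiffAt_idChartSymm (eventually_idChart_idChartSymm (N := N)).self_of_nhds.2.2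

theorem contDiffAt_localMul : ContDiffAt ℝ ∞ (localMul N : E × E → E) 0 := by
  rw [← contMDiffAt_iff_contDiffAt]
  have h1 : ContMDiffAt 𝓘(ℝ, E × E) 𝓘(ℝ, E) ∞
      (fun p : E × E => idChartSymm N p.1) 0 :=
    ContMDiffAt.comp (g := idChartSymm N) (f := Prod.fst) (0 : E × E)
      contMDiffAt_idChartSymm_zero contDiff_fst.contMDiff.contMDiffAt
  have h2 : ContMDiffAt 𝓘(ℝ, E × E) 𝓘(ℝ, E) ∞
      (fun p : E × E => idChartSymm N p.2) 0 :=
    ContMDiffAt.comp (g := idChartSymm N) (f := Prod.snd) (0 : E × E)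
      contMDiffAt_idChartSymm_zero contDiff_snd.contMDiff.contMDiffAt
  refine ContMDiffAt.comp (0 : E × E) (g := idChart E) ?_ (h1.mul h2)
  exact contMDiffAt_idChart (by simpa using one_mem_idChartSource)

/-- The derivative at the identity of the chart at the identity is the identity map. -/
theorem hasMFDerivAt_idChart_one :
    HasMFDerivAt 𝓘(ℝ, E) 𝓘(ℝ, E) (idChart E : N → E) 1
      (ContinuousLinearMap.id ℝ (TangentSpace 𝓘(ℝ, E) (1 : N))) := by
  have h1 := (mdifferentiableAt_extChartAt (I := 𝓘(ℝ, E)) (mem_chart_source E (1 : N))).hasMFDerivAt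
  rw [mfderiv_extChartAt_self] at h1
  have h2 : HasMFDerivAt 𝓘(ℝ, E) 𝓘(ℝ, E) (fun x : E => x - extChartAt 𝓘(ℝ, E) (1 : N) 1)
      (extChartAt 𝓘(ℝ, E) (1 : N) 1) (ContinuousLinearMap.id ℝ E) :=
    ((hasFDerivAt_id _).sub_const _).hasMFDerivAt
  exact h2.comp 1 h1

theorem hasMFDerivAt_idChartSymm_zero :
    HasMFDerivAt 𝓘(ℝ, E) 𝓘(ℝ, E) (idChartSymm N : E → N) 0
      (ContinuousLinearMap.id ℝ E) := by
  have h1 := (contMDiffAt_idChartSymm_zero (E := E) (N := N)).mdifferentiableAt (by simp)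
  have h2 := h1.hasMFDerivAt
  have h3 : ∀ g : N, g = 1 → HasMFDerivAt 𝓘(ℝ, E) 𝓘(ℝ, E) (idChart E : N → E) g
      (ContinuousLinearMap.id ℝ E) := by
    rintro _ rfl
    exact hasMFDerivAt_idChart_one
  have h4 := ((h3 _ idChartSymm_zero).comp 0 h2).hasFDerivAt
  have h5 : HasFDerivAt (idChart E ∘ idChartSymm N : E → E) (ContinuousLinearMap.id ℝ E) 0 :=
    (hasFDerivAt_id 0).congr_of_eventuallyEq
      ((eventually_idChart_idChartSymm (N := N)).mono fun x hx => hx.2.1)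
  have h6 : mfderiv 𝓘(ℝ, E) 𝓘(ℝ, E) (idChartSymm N : E → N) 0 = ContinuousLinearMap.id ℝ E :=
    (h5.unique h4).symm
  rwa [h6] at h2

end IdChart

/-! ### The Lie bracket in the chart at the identity -/

section LocalMul

open Set Filter Topology

variable {E : Type*} [NormedAddCommGroup E] [NormedSpace ℝ E]
  (N : Type*) [TopologicalSpace N] [ChartedSpace E N] [Group N]

/-- The derivative at the identity of left translation by the point of coordinate `x`, read in the
chart at the identity. -/
noncomputable def localLeft (x : E) : E →L[ℝ] E :=
  fderiv ℝ (localMul N) (x, 0) ∘L ContinuousLinearMap.inr ℝ E E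

/-- The derivative at the identity of right translation by the point of coordinate `x`, read in the
chart at the identity. -/
noncomputable def localRight (x : E) : E →L[ℝ] E :=
  fderiv ℝ (localMul N) (0, x) ∘L ContinuousLinearMap.inl ℝ E E

variable (E) in
/-- The bracket of the Lie algebra, obtained by linearising at the identity the difference between
left and right translations. -/
noncomputable def chartBracket : E →L[ℝ] E →L[ℝ] E :=
  fderiv ℝ (fun x : E => localLeft N x - localRight N x) 0

variable [LieGroup 𝓘(ℝ, E) ∞ N]

theorem contDiffAt_fderiv_localMul : ContDiffAt ℝ ∞ (fderiv ℝ (localMul N)) (0 : E × E) :=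
  contDiffAt_localMul.fderiv_right (by simp)

theorem contDiffAt_localLeft : ContDiffAt ℝ ∞ (localLeft N : E → E →L[ℝ] E) 0 := by
  have h : ContDiffAt ℝ ∞ (fun x : E => fderiv ℝ (localMul N) (x, (0 : E))) 0 :=
    ContDiffAt.comp (0 : E) (f := fun x : E => (x, (0 : E))) (contDiffAt_fderiv_localMul N)
      (contDiff_id.prodMk contDiff_const).contDiffAt
  exact h.clm_comp contDiffAt_const

theorem contDiffAt_localRight : ContDiffAt ℝ ∞ (localRight N : E → E →L[ℝ] E) 0 := by
  have h : ContDiffAt ℝ ∞ (fun x : E => fderiv ℝ (localMul N) ((0 : E), x)) 0 :=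
    ContDiffAt.comp (0 : E) (f := fun x : E => ((0 : E), x)) (contDiffAt_fderiv_localMul N)
      (contDiff_const.prodMk contDiff_id).contDiffAt
  exact h.clm_comp contDiffAt_const

theorem hasFDerivAt_localLeft_sub_localRight :
    HasFDerivAt (fun x : E => localLeft N x - localRight N x) (chartBracket E N) 0 :=
  (((contDiffAt_localLeft N).sub (contDiffAt_localRight N)).differentiableAt (by simp)).hasFDerivAt

theorem eventually_differentiableAt_localMul :
    ∀ᶠ p in 𝓝 (0 : E × E), DifferentiableAt ℝ (localMul N) p := by
  have h : ContDiffAt ℝ 1 (localMul N) (0 : E × E) := contDiffAt_localMul.of_le (by simp)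
  filter_upwards [h.eventually (by simp)] with p hp
  exact hp.differentiableAt (by simp)

/-- Near the identity, `localMul` has derivative `(v, w) ↦ v + localLeft x w` at `(x, 0)`. -/
theorem eventually_hasFDerivAt_localMul_left : ∀ᶠ x in 𝓝 (0 : E),
    HasFDerivAt (localMul N) ((ContinuousLinearMap.fst ℝ E E) +
      (localLeft N x) ∘L (ContinuousLinearMap.snd ℝ E E)) (x, 0) := by
  have hc : Tendsto (fun x : E => (x, (0 : E))) (𝓝 0) (𝓝 0) :=
    (continuous_id.prodMk continuous_const).tendsto 0
  filter_upwards [hc.eventually (eventually_differentiableAt_localMul N),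
    (eventually_localMul_zero_right (N := N)).eventually_nhds] with x hx hx0
  have h1 := hx.hasFDerivAt
  have h2 : HasFDerivAt (fun y : E => localMul N (y, 0))
      (fderiv ℝ (localMul N) (x, 0) ∘L ContinuousLinearMap.inl ℝ E E) x :=
    HasFDerivAt.comp (f := fun y : E => (y, (0 : E))) x h1 (hasFDerivAt_prodMk_left x (0 : E))
  have h3 : HasFDerivAt (fun y : E => localMul N (y, 0)) (ContinuousLinearMap.id ℝ E) x :=
    (hasFDerivAt_id x).congr_of_eventuallyEq hx0
  have h4 := h2.unique h3
  convert h1 using 1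
  ext1
  · simpa [ContinuousLinearMap.add_comp, ContinuousLinearMap.comp_assoc] using h4.symm
  · ext y
    simp [localLeft]

/-- Near the identity, `localMul` has derivative `(v, w) ↦ localRight x v + w` at `(0, x)`. -/
theorem eventually_hasFDerivAt_localMul_right : ∀ᶠ x in 𝓝 (0 : E),
    HasFDerivAt (localMul N) ((localRight N x) ∘L (ContinuousLinearMap.fst ℝ E E) +
      (ContinuousLinearMap.snd ℝ E E)) (0, x) := by
  have hc : Tendsto (fun x : E => ((0 : E), x)) (𝓝 0) (𝓝 0) :=
    (continuous_const.prodMk continuous_id).tendsto 0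
  filter_upwards [hc.eventually (eventually_differentiableAt_localMul N),
    (eventually_localMul_zero_left (N := N)).eventually_nhds] with x hx hx0
  have h1 := hx.hasFDerivAt
  have h2 : HasFDerivAt (fun y : E => localMul N (0, y))
      (fderiv ℝ (localMul N) (0, x) ∘L ContinuousLinearMap.inr ℝ E E) x :=
    HasFDerivAt.comp x h1 (hasFDerivAt_prodMk_right 0 x)
  have h3 : HasFDerivAt (fun y : E => localMul N (0, y)) (ContinuousLinearMap.id ℝ E) x :=
    (hasFDerivAt_id x).congr_of_eventuallyEq hx0
  have h4 := h2.unique h3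
  convert h1 using 1
  ext1
  · ext y
    simp [localRight]
  · simpa [ContinuousLinearMap.add_comp, ContinuousLinearMap.comp_assoc] using h4.symm

theorem localLeft_zero : localLeft N (0 : E) = 1 := by
  have h1 := (eventually_hasFDerivAt_localMul_left (E := E) N).self_of_nhds
  have h2 := (eventually_hasFDerivAt_localMul_right (E := E) N).self_of_nhds
  have h3 := congrArg (fun A => A ∘L ContinuousLinearMap.inr ℝ E E) (h1.unique h2)
  ext y
  simpa using congrArg (fun A => A y) h3

theorem localRight_zero : localRight N (0 : E) = 1 := by
  have h1 := (eventually_hasFDerivAt_localMul_left (E := E) N).self_of_nhds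
  have h2 := (eventually_hasFDerivAt_localMul_right (E := E) N).self_of_nhds
  have h3 := congrArg (fun A => A ∘L ContinuousLinearMap.inl ℝ E E) (h1.unique h2)
  ext y
  simpa using (congrArg (fun A => A y) h3).symm

theorem fderiv_localLeft_apply (u v : E) : fderiv ℝ (localLeft N) 0 u v =
    fderiv ℝ (fderiv ℝ (localMul N)) (0 : E × E) (u, 0) (0, v) := by
  have h1 : HasFDerivAt (fderiv ℝ (localMul N)) (fderiv ℝ (fderiv ℝ (localMul N)) (0 : E × E))
    ((0 : E), (0 : E)) := ((contDiffAt_fderiv_localMul N).differentiableAt (by simp)).hasFDerivAt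
  have h2 := (HasFDerivAt.comp (f := fun y : E => (y, (0 : E))) (0 : E) h1
    (hasFDerivAt_prodMk_left (0 : E) (0 : E))).clm_comp
    (hasFDerivAt_const (ContinuousLinearMap.inr ℝ E E) (0 : E))
  have h3 : HasFDerivAt (localLeft N) _ (0 : E) := h2
  rw [h3.fderiv]
  simp

theorem fderiv_localRight_apply (u v : E) : fderiv ℝ (localRight N) 0 u v =
    fderiv ℝ (fderiv ℝ (localMul N)) (0 : E × E) (0, u) (v, 0) := by
  have h1 : HasFDerivAt (fderiv ℝ (localMul N)) (fderiv ℝ (fderiv ℝ (localMul N)) (0 : E × E))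
    ((0 : E), (0 : E)) := ((contDiffAt_fderiv_localMul N).differentiableAt (by simp)).hasFDerivAt
  have h2 := (HasFDerivAt.comp (0 : E) h1 (hasFDerivAt_prodMk_right 0 0)).clm_comp
    (hasFDerivAt_const (ContinuousLinearMap.inl ℝ E E) (0 : E))
  have h3 : HasFDerivAt (localRight N) _ (0 : E) := h2
  rw [h3.fderiv]
  simp

/-- By symmetry of the second derivative of `localMul`, right translations contribute the derivative
of left translations with the arguments exchanged. -/
theorem chartBracket_apply (u v : E) : chartBracket E N u v =
    fderiv ℝ (localLeft N) 0 u v - fderiv ℝ (localLeft N) 0 v u := by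
  have hs : IsSymmSndFDerivAt ℝ (localMul N) (0 : E × E) :=
    contDiffAt_localMul.isSymmSndFDerivAt (by
      rw [minSmoothness_of_isRCLikeNormedField]
      exact ENat.LEInfty.out)
  have h1 : chartBracket E N = fderiv ℝ (localLeft N) 0 - fderiv ℝ (localRight N) 0 :=
    fderiv_fun_sub ((contDiffAt_localLeft N).differentiableAt (by simp))
      ((contDiffAt_localRight N).differentiableAt (by simp))
  rw [h1]
  simp only [sub_apply, fderiv_localRight_apply, fderiv_localLeft_apply]
  rw [hs.eq (v, 0) (0, u)]

/-- In the chart at the identity, the left-invariant vector field of `v` is `x ↦ localLeft x v`. -/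
theorem eventually_mpullback_mulInvariantVectorField (v : GroupLieAlgebra 𝓘(ℝ, E) N) :
    ∀ᶠ x in 𝓝 (0 : E), VectorField.mpullbackWithin 𝓘(ℝ, E) 𝓘(ℝ, E)
      (extChartAt 𝓘(ℝ, E) (1 : N)).symm (mulInvariantVectorField (I := 𝓘(ℝ, E)) v)
        (range 𝓘(ℝ, E)) (x + extChartAt 𝓘(ℝ, E) (1 : N) 1) = localLeft N x v := by
  have hsrc : ∀ᶠ x in 𝓝 (0 : E), idChartSymm N x ∈ idChartSource E N ∧
      idChart E (idChartSymm N x) = x ∧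
      x + extChartAt 𝓘(ℝ, E) (1 : N) 1 ∈ (extChartAt 𝓘(ℝ, E) (1 : N)).target :=
    eventually_idChart_idChartSymm
  filter_upwards [hsrc, eventually_hasFDerivAt_localMul_left N,
    eventually_localMul_zero_right (N := N)] with x hx hxd hx0
  set g := idChartSymm N x with hg
  -- left translation by `g` near the identity, expressed through `localMul`
  have hcont : ContinuousAt (fun y : E => g * idChartSymm N y) 0 := by
    have := topologicalGroup_of_lieGroup 𝓘(ℝ, E) ∞ (G := N)
    exact continuousAt_const.mul contMDiffAt_idChartSymm_zero.continuousAt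
  have hev : (fun y : E => g * idChartSymm N y) =ᶠ[𝓝 0]
      (idChartSymm N) ∘ fun y : E => localMul N (x, y) := by
    have : ∀ᶠ y in 𝓝 (0 : E), g * idChartSymm N y ∈ idChartSource E N :=
      hcont.eventually (isOpen_idChartSource.mem_nhds (by simpa using hx.1))
    filter_upwards [this] with y hy
    simp only [Function.comp_apply, localMul]
    rw [idChartSymm_idChart hy]
  have hL : HasFDerivAt (fun y : E => localMul N (x, y)) (localLeft N x) 0 := by
    have := HasFDerivAt.comp (0 : E) hxd (hasFDerivAt_prodMk_right x 0)
    convert! this using 1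
    ext y
    simp
  have hS : HasMFDerivAt 𝓘(ℝ, E) 𝓘(ℝ, E) (idChartSymm N) (localMul N (x, (0 : E)))
      (mfderiv 𝓘(ℝ, E) 𝓘(ℝ, E) (extChartAt 𝓘(ℝ, E) (1 : N)).symm
        (x + extChartAt 𝓘(ℝ, E) (1 : N) 1)) := by
    rw [hx0]
    have h1 := ((contMDiffOn_extChartAt_symm (I := 𝓘(ℝ, E)) (n := ∞) (1 : N)).contMDiffAt
      ((isOpen_extChartAt_target (I := 𝓘(ℝ, E)) (1 : N)).mem_nhds hx.2.2)).mdifferentiableAt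
        (by simp) |>.hasMFDerivAt
    exact h1.comp x (((hasFDerivAt_id x).add_const _).hasMFDerivAt)
  have h1 := (hS.comp 0 hL.hasMFDerivAt).congr_of_eventuallyEq hev
  have h2 : HasMFDerivAt 𝓘(ℝ, E) 𝓘(ℝ, E) (fun y : E => g * idChartSymm N y) 0
      ((mfderiv 𝓘(ℝ, E) 𝓘(ℝ, E) (g * ·) (1 : N)) ∘L (ContinuousLinearMap.id ℝ E)) := by
    have hm : ∀ h : N, h = 1 → HasMFDerivAt 𝓘(ℝ, E) 𝓘(ℝ, E) (g * ·) h
        (mfderiv 𝓘(ℝ, E) 𝓘(ℝ, E) (g * ·) (1 : N)) := by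
      rintro _ rfl
      exact ((contMDiff_mul_left (I := 𝓘(ℝ, E)) (n := ∞) (a := g)).mdifferentiableAt
        (by simp)).hasMFDerivAt
    exact (hm _ idChartSymm_zero).comp 0 hasMFDerivAt_idChartSymm_zero
  have h3 := congrArg (fun A => A v) (hasMFDerivAt_unique h1 h2)
  have hinv := isInvertible_mfderivWithin_extChartAt_symm (I := 𝓘(ℝ, E)) hx.2.2
  rw [VectorField.mpullbackWithin_apply]
  rw [ModelWithCorners.range_eq_univ, mfderivWithin_univ] at hinv ⊢
  exact hinv.inverse_apply_eq.2 h3.symm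

/-- The Lie bracket of left-invariant vector fields, evaluated at the identity, is `chartBracket`:
both are the antisymmetrised derivative of `localLeft` at `0`. -/
theorem groupLieAlgebra_lie_eq (v w : GroupLieAlgebra 𝓘(ℝ, E) N) :
    ⁅v, w⁆ = chartBracket E N v w := by
  set c₁ : E := extChartAt 𝓘(ℝ, E) (1 : N) 1 with hc₁
  let P : GroupLieAlgebra 𝓘(ℝ, E) N → E → E := fun v =>
    VectorField.mpullbackWithin 𝓘(ℝ, E) 𝓘(ℝ, E) (extChartAt 𝓘(ℝ, E) (1 : N)).symm
      (mulInvariantVectorField (I := 𝓘(ℝ, E)) v) (range 𝓘(ℝ, E))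
  -- near the identity the vector fields `P v` are given by the smooth operators `localLeft`
  let Q : E → E → E := fun v z => localLeft N (z - c₁) v
  have hP : ∀ v, P v =ᶠ[𝓝 c₁] Q v := fun v => by
    have ht : Tendsto (fun z : E => z - c₁) (𝓝 c₁) (𝓝 0) := by
      have : Continuous (fun z : E => z - c₁) := by fun_prop
      simpa using this.tendsto c₁
    filter_upwards [ht.eventually (eventually_mpullback_mulInvariantVectorField N v)] with z hz
    rw [sub_add_cancel] at hz
    exact hz
  have hQ : ∀ u v : E, fderiv ℝ (Q v) c₁ u = fderiv ℝ (localLeft N) 0 u v := fun u v => by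
    have h0 : HasFDerivAt (localLeft N : E → E →L[ℝ] E) (fderiv ℝ (localLeft N) 0) (c₁ - c₁) := by
      rw [sub_self]
      exact ((contDiffAt_localLeft N).differentiableAt (by simp)).hasFDerivAt
    have h1 : HasFDerivAt (fun z => localLeft N (z - c₁)) _ c₁ :=
      h0.comp (f := fun z => z - c₁) c₁ ((hasFDerivAt_id c₁).sub_const c₁)
    have h2 : HasFDerivAt (Q v) _ c₁ := h1.clm_apply (hasFDerivAt_const v c₁)
    rw [h2.fderiv]
    simp
  have hQ0 : ∀ v : E, Q v c₁ = v := fun v => by simp [Q, localLeft_zero]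
  have h1 : ⁅v, w⁆ = (mfderiv 𝓘(ℝ, E) 𝓘(ℝ, E) (extChartAt 𝓘(ℝ, E) (1 : N)) 1).inverse
      (VectorField.lieBracketWithin ℝ (P v) (P w)
        ((extChartAt 𝓘(ℝ, E) (1 : N)).symm ⁻¹' univ ∩ range 𝓘(ℝ, E)) c₁ : E) := rfl
  rw [preimage_univ, univ_inter, ModelWithCorners.range_eq_univ,
    VectorField.lieBracketWithin_univ, (hP v).lieBracket_vectorField_eq (hP w),
    mfderiv_extChartAt_self] at h1
  have h2 : ∀ v w : E, VectorField.lieBracket ℝ (Q v) (Q w) c₁ = chartBracket E N v w :=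
    fun v w => by
      rw [VectorField.lieBracket_eq]
      simp only [hQ, hQ0, chartBracket_apply]
  have h3 : ∀ z : E, (ContinuousLinearMap.id ℝ E).inverse z = z := fun z => by
    rw [ContinuousLinearMap.inverse_id]
    rfl
  exact (h1.trans (h3 _)).trans (h2 v w)

end LocalMul

/-! ### One-parameter subgroups -/

section OneParameter

open Set Filter Topology

variable {E : Type*} [NormedAddCommGroup E] [NormedSpace ℝ E]
  (N : Type*) [TopologicalSpace N] [ChartedSpace E N] [Group N]

/-- The exponential map of the group, as a function on the model space. -/
noncomputable def modelExp (x : E) : N := lieExp (N := N) (x : GroupLieAlgebra 𝓘(ℝ, E) N)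

/-- The left-invariant vector field of a vector of the model space. -/
noncomputable def leftField (x : E) (g : N) : TangentSpace 𝓘(ℝ, E) g :=
  mulInvariantVectorField (I := 𝓘(ℝ, E)) (G := N) x g

variable [LieGroup 𝓘(ℝ, E) ∞ N]

theorem t2Space_of_lieGroup (E : Type*) [NormedAddCommGroup E] [NormedSpace ℝ E]
    (N : Type*) [TopologicalSpace N] [ChartedSpace E N] [Group N] [LieGroup 𝓘(ℝ, E) ∞ N] :
    T2Space N := by
  have := topologicalGroup_of_lieGroup 𝓘(ℝ, E) ∞ (G := N)
  have : T1Space N := 𝓘(ℝ, E).t1Space N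
  infer_instance

variable {N}

theorem contMDiff_leftField (x : E) : ContMDiff 𝓘(ℝ, E) 𝓘(ℝ, E).tangent 1
    (fun g : N => (⟨g, leftField N x g⟩ : TangentBundle 𝓘(ℝ, E) N)) :=
  (contMDiff_mulInvariantVectorField (I := 𝓘(ℝ, E)) (G := N) x).of_le (by
    rw [minSmoothness_of_isRCLikeNormedField]
    norm_num)

theorem hasMFDerivAt_mul_left (g h : N) : HasMFDerivAt 𝓘(ℝ, E) 𝓘(ℝ, E) (g * ·) h
    (mfderiv 𝓘(ℝ, E) 𝓘(ℝ, E) (g * ·) h) :=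
  ((contMDiff_mul_left (I := 𝓘(ℝ, E)) (n := ∞) (a := g)).mdifferentiableAt (by simp)).hasMFDerivAt

theorem mfderiv_mul_left_leftField (x : E) (g h : N) :
    mfderiv 𝓘(ℝ, E) 𝓘(ℝ, E) (g * ·) h (leftField N x h) = leftField N x (g * h) := by
  have h1 : HasMFDerivAt 𝓘(ℝ, E) 𝓘(ℝ, E) (h * ·) (1 : N) _ := hasMFDerivAt_mul_left h 1
  have h2 : ∀ k : N, k = h → HasMFDerivAt 𝓘(ℝ, E) 𝓘(ℝ, E) (g * ·) k
      (mfderiv 𝓘(ℝ, E) 𝓘(ℝ, E) (g * ·) h) := by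
    rintro _ rfl
    exact hasMFDerivAt_mul_left _ _
  have h3 := (h2 (h * 1) (mul_one h)).comp 1 h1
  have h4 : HasMFDerivAt 𝓘(ℝ, E) 𝓘(ℝ, E) (g * h * ·) (1 : N) _ := hasMFDerivAt_mul_left (g * h) 1
  have h5 : ((g * ·) ∘ (h * ·)) = (g * h * · : N → N) := by
    funext k
    simp [mul_assoc]
  rw [h5] at h3
  exact congrArg (fun A => A x) (hasMFDerivAt_unique h3 h4)

theorem ContinuousLinearMap.smulRight_one_eq_comp {A : E →L[ℝ] E} {v w : E} (h : A v = w) :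
    ContinuousLinearMap.smulRight (1 : ℝ →L[ℝ] ℝ) w =
      A ∘L ContinuousLinearMap.smulRight (1 : ℝ →L[ℝ] ℝ) v := by
  ext
  simp [h]

theorem IsMIntegralCurveOn.mul_left {x : E} {γ : ℝ → N} {s : Set ℝ}
    (hγ : IsMIntegralCurveOn γ (leftField N x) s) (g : N) :
    IsMIntegralCurveOn (fun t => g * γ t) (leftField N x) s := by
  intro t ht
  have h1 := (hasMFDerivAt_mul_left (E := E) g (γ t)).comp_hasMFDerivWithinAt t (hγ t ht)
  refine HasMFDerivWithinAt.congr_mfderiv h1 ?_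
  exact (ContinuousLinearMap.smulRight_one_eq_comp (E := E)
    (A := mfderiv 𝓘(ℝ, E) 𝓘(ℝ, E) (g * ·) (γ t)) (v := leftField N x (γ t))
    (w := leftField N x (g * γ t)) (mfderiv_mul_left_leftField x g (γ t))).symm

theorem IsMIntegralCurve.mul_left {x : E} {γ : ℝ → N}
    (hγ : IsMIntegralCurve γ (leftField N x)) (g : N) :
    IsMIntegralCurve (fun t => g * γ t) (leftField N x) := by
  rw [isMIntegralCurve_iff_isMIntegralCurveOn] at hγ ⊢
  exact hγ.mul_left g

/-- Left-invariant vector fields are complete: by translation, the existence time of integral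
curves is uniform. -/
theorem exists_isMIntegralCurve_leftField [CompleteSpace E] (x : E) :
    ∃ γ : ℝ → N, γ 0 = 1 ∧ IsMIntegralCurve γ (leftField N x) := by
  have := t2Space_of_lieGroup E N
  obtain ⟨γ, h0, hγ⟩ := exists_isMIntegralCurveAt_of_contMDiffAt_boundaryless (0 : ℝ)
    ((contMDiff_leftField x).contMDiffAt (x := (1 : N)))
  rw [isMIntegralCurveAt_iff'] at hγ
  obtain ⟨ε, hε, hγ⟩ := hγ
  rw [Real.ball_eq_Ioo, zero_sub, zero_add] at hγ
  exact exists_isMIntegralCurve_of_isMIntegralCurveOn (contMDiff_leftField x) hε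
    (fun g => ⟨fun t => g * γ t, by simp [h0], hγ.mul_left g⟩) 1

theorem isMIntegralCurve_leftField_unique {x : E} {γ γ' : ℝ → N}
    (hγ : IsMIntegralCurve γ (leftField N x)) (hγ' : IsMIntegralCurve γ' (leftField N x))
    (h0 : γ 0 = γ' 0) : γ = γ' := by
  have := t2Space_of_lieGroup E N
  exact isMIntegralCurve_Ioo_eq_of_contMDiff_boundaryless (contMDiff_leftField x) hγ hγ' h0

theorem modelExp_eq [CompleteSpace E] {x : E} {γ : ℝ → N} (h0 : γ 0 = 1)
    (hγ : IsMIntegralCurve γ (leftField N x)) : modelExp N x = γ 1 := by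
  have h : ∃ γ : ℝ → N, γ 0 = 1 ∧ IsMIntegralCurve (I := 𝓘(ℝ, E)) γ
    (mulInvariantVectorField (I := 𝓘(ℝ, E)) (x : GroupLieAlgebra 𝓘(ℝ, E) N)) := ⟨γ, h0, hγ⟩
  have h1 : modelExp N x = h.choose 1 := dif_pos h
  rw [h1]
  exact congrFun (isMIntegralCurve_leftField_unique h.choose_spec.2 hγ
    (h.choose_spec.1.trans h0.symm)) 1

theorem modelExp_smul_eq [CompleteSpace E] {x : E} {γ : ℝ → N} (h0 : γ 0 = 1)
    (hγ : IsMIntegralCurve γ (leftField N x)) (t : ℝ) : modelExp N (t • x) = γ t := by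
  have h1 : leftField N (t • x) = t • leftField N x :=
    mulInvariantVectorField_smul (I := 𝓘(ℝ, E)) (G := N) t x
  have h2 := hγ.comp_mul t
  rw [← h1] at h2
  have := modelExp_eq (γ := γ ∘ (· * t)) (by simpa using h0) h2
  simpa using this

theorem isMIntegralCurve_modelExp [CompleteSpace E] (x : E) :
    IsMIntegralCurve (fun t : ℝ => modelExp N (t • x)) (leftField N x) := by
  obtain ⟨γ, h0, hγ⟩ := exists_isMIntegralCurve_leftField (N := N) x
  have : (fun t : ℝ => modelExp N (t • x)) = γ := funext fun t => modelExp_smul_eq h0 hγ t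
  rwa [this]

@[simp] theorem modelExp_zero [CompleteSpace E] : modelExp N (0 : E) = 1 := by
  obtain ⟨γ, h0, hγ⟩ := exists_isMIntegralCurve_leftField (N := N) (0 : E)
  simpa [h0] using modelExp_smul_eq h0 hγ 0

theorem isMIntegralCurve_leftField_eq [CompleteSpace E] {x : E} {γ : ℝ → N}
    (hγ : IsMIntegralCurve γ (leftField N x)) (t : ℝ) : γ t = γ 0 * modelExp N (t • x) :=
  congrFun (isMIntegralCurve_leftField_unique hγ ((isMIntegralCurve_modelExp x).mul_left (γ 0))
    (by simp)) t

theorem modelExp_add_smul [CompleteSpace E] (x : E) (s t : ℝ) :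
    modelExp N ((s + t) • x) = modelExp N (s • x) * modelExp N (t • x) := by
  have := isMIntegralCurve_leftField_eq ((isMIntegralCurve_modelExp (N := N) x).comp_add s) t
  simpa [add_comm] using this

theorem modelExp_neg [CompleteSpace E] (x : E) : modelExp N (-x) = (modelExp N x)⁻¹ := by
  have := modelExp_add_smul (N := N) x (-1) 1
  rw [neg_add_cancel, zero_smul, modelExp_zero, neg_one_smul, one_smul] at this
  exact eq_inv_of_mul_eq_one_left this.symm

theorem continuous_modelExp_smul [CompleteSpace E] (x : E) :
    Continuous fun t : ℝ => modelExp N (t • x) :=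
  (isMIntegralCurve_modelExp x).continuous

theorem leftField_one (x : E) : leftField N x 1 = x := by
  have h1 := hasMFDerivAt_mul_left (E := E) (1 : N) 1
  have h2 : HasMFDerivAt 𝓘(ℝ, E) 𝓘(ℝ, E) (1 * · : N → N) 1
      (ContinuousLinearMap.id ℝ (TangentSpace 𝓘(ℝ, E) (1 : N))) := by
    have : (1 * · : N → N) = id := by funext; simp
    rw [this]
    exact hasMFDerivAt_id 1
  exact congrArg (fun A => A x) (hasMFDerivAt_unique h1 h2)

theorem hasDerivAt_idChart_modelExp [CompleteSpace E] (x : E) :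
    HasDerivAt (fun t : ℝ => idChart E (modelExp N (t • x))) x 0 := by
  have h1 := isMIntegralCurve_modelExp (N := N) x 0
  have h2 : ∀ g : N, g = 1 → HasMFDerivAt 𝓘(ℝ, E) 𝓘(ℝ, E) (idChart E : N → E) g
      (ContinuousLinearMap.id ℝ E) := by
    rintro _ rfl
    exact hasMFDerivAt_idChart_one
  have h3 : ∀ g : N, g = 1 → (leftField N x g : E) = x := by
    rintro _ rfl
    exact leftField_one x
  have h4 : HasMFDerivAt 𝓘(ℝ, ℝ) 𝓘(ℝ, E) (fun t : ℝ => idChart E (modelExp N (t • x))) 0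
      (ContinuousLinearMap.smulRight (1 : ℝ →L[ℝ] ℝ) x) := by
    refine ((h2 _ (by simp)).comp 0 h1).congr_mfderiv ?_
    exact (ContinuousLinearMap.smulRight_one_eq_comp (E := E) (A := ContinuousLinearMap.id ℝ E)
      (v := leftField N x (modelExp N ((0 : ℝ) • x))) (w := x) (h3 _ (by simp))).symm
  have h5 : HasFDerivAt (fun t : ℝ => idChart E (modelExp N (t • x)))
      (ContinuousLinearMap.smulRight (1 : ℝ →L[ℝ] ℝ) x) 0 := h4.hasFDerivAt
  simpa using h5.hasDerivAt

/-- A curve in the group has velocity the left translate of `v` as soon as its left translate to the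
identity, read in the chart, has velocity `v`. -/
theorem hasMFDerivAt_of_idChart {c : ℝ → N} {t : ℝ} {v : E} (hc : ContinuousAt c t)
    (hd : HasDerivAt (fun s => idChart E ((c t)⁻¹ * c s)) v t) :
    HasMFDerivAt 𝓘(ℝ, ℝ) 𝓘(ℝ, E) c t
      (ContinuousLinearMap.smulRight (1 : ℝ →L[ℝ] ℝ) (leftField N v (c t))) := by
  have := topologicalGroup_of_lieGroup 𝓘(ℝ, E) ∞ (G := N)
  have h1 : ∀ y : E, y = 0 → HasMFDerivAt 𝓘(ℝ, E) 𝓘(ℝ, E) (idChartSymm N : E → N) y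
      (ContinuousLinearMap.id ℝ E) := by
    rintro _ rfl
    exact hasMFDerivAt_idChartSymm_zero
  have h2 : ∀ h : N, h = 1 → HasMFDerivAt 𝓘(ℝ, E) 𝓘(ℝ, E) (c t * ·) h
      (mfderiv 𝓘(ℝ, E) 𝓘(ℝ, E) (c t * ·) 1) := by
    rintro _ rfl
    exact hasMFDerivAt_mul_left _ _
  have h3 := (h1 (idChart E ((c t)⁻¹ * c t)) (by simp)).comp t hd.hasFDerivAt.hasMFDerivAt
  have h4 := (h2 ((idChartSymm N ∘ fun s => idChart E ((c t)⁻¹ * c s)) t) (by simp)).comp t h3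
  have hev : c =ᶠ[𝓝 t] (c t * ·) ∘ (idChartSymm N ∘ fun s => idChart E ((c t)⁻¹ * c s)) := by
    have hm : ∀ᶠ s in 𝓝 t, (c t)⁻¹ * c s ∈ idChartSource E N := by
      have : ContinuousAt (fun s => (c t)⁻¹ * c s) t := continuousAt_const.mul hc
      exact this.eventually (by simpa using idChartSource_mem_nhds)
    filter_upwards [hm] with s hs
    simp [idChartSymm_idChart hs]
  have h5 := h4.congr_of_eventuallyEq hev
  refine h5.congr_mfderiv ?_
  exact (ContinuousLinearMap.smulRight_one_eq_comp (E := E)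
    (A := mfderiv 𝓘(ℝ, E) 𝓘(ℝ, E) (c t * ·) 1) (v := v) (w := leftField N v (c t)) rfl).symm

end OneParameter

/-! ### The derivative of the exponential map -/

section DerivExp

open Set Filter Topology

/-- A continuous curve stays in an open set `O` if, as long as it does so, it lies in a smaller
closed set. -/
theorem mem_of_forall_Icc_mem {X : Type*} [TopologicalSpace X] {U : ℝ → X} (hU : Continuous U)
    {O C : Set X} (hO : IsOpen O) (hC : IsClosed C) (hCO : C ⊆ O) (h0 : U 0 ∈ O)
    (h : ∀ T ∈ Icc (0 : ℝ) 1, (∀ t ∈ Icc 0 T, U t ∈ O) → U T ∈ C) :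
    ∀ t ∈ Icc (0 : ℝ) 1, U t ∈ O := by
  by_contra! hcon
  set B : Set ℝ := Icc 0 1 ∩ U ⁻¹' Oᶜ with hB
  have hBc : IsClosed B := isClosed_Icc.inter (hO.isClosed_compl.preimage hU)
  have hBb : BddBelow B := ⟨0, fun t ht => ht.1.1⟩
  have hBn : B.Nonempty := let ⟨t, ht, htO⟩ := hcon; ⟨t, ht, htO⟩
  have hmem := hBc.csInf_mem hBn hBb
  set t₀ := sInf B
  have hlt : ∀ t ∈ Ico 0 t₀, U t ∈ C := fun T hT => h T ⟨hT.1, hT.2.le.trans hmem.1.2⟩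
    fun t ht => by
      by_contra htO
      exact notMem_of_lt_csInf (lt_of_le_of_lt ht.2 hT.2) hBb
        ⟨⟨ht.1, (ht.2.trans hT.2.le).trans hmem.1.2⟩, htO⟩
  have ht0 : (0 : ℝ) ≠ t₀ := fun h0' => hmem.2 (by rw [← h0']; exact h0)
  have hcl : t₀ ∈ closure (Ico 0 t₀) := by
    rw [closure_Ico ht0]
    exact ⟨hmem.1.1, le_rfl⟩
  exact hmem.2 (hCO (closure_minimal (fun t ht => hlt t ht) (hC.preimage hU) hcl))

variable {E : Type*} [NormedAddCommGroup E] [NormedSpace ℝ E]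
  {N : Type*} [TopologicalSpace N] [ChartedSpace E N] [Group N] [LieGroup 𝓘(ℝ, E) ∞ N]

/-- The curve `s ↦ exp (-s x) * exp (s (x + y))`, read in the chart at the identity, satisfies a
differential equation that only involves the derivatives of left and right translations. -/
theorem hasDerivAt_idChart_exp_mul_exp [CompleteSpace E] : ∀ᶠ z in 𝓝 (0 : E), ∀ (x y : E) (s : ℝ),
    modelExp N (s • -x) * modelExp N (s • (x + y)) ∈ idChartSource E N →
    idChart E (modelExp N (s • -x) * modelExp N (s • (x + y))) = z →
    HasDerivAt (fun s : ℝ => idChart E (modelExp N (s • -x) * modelExp N (s • (x + y))))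
      ((localLeft N z - localRight N z) x + localLeft N z y) s := by
  have := topologicalGroup_of_lieGroup 𝓘(ℝ, E) ∞ (G := N)
  filter_upwards [eventually_hasFDerivAt_localMul_left N, eventually_hasFDerivAt_localMul_right N]
    with z hzl hzr x y s hs hz
  set U : N := modelExp N (s • -x) * modelExp N (s • (x + y)) with hU
  -- at time `s + r` the curve is `exp (-r x) * U * exp (r (x + y))`, with both factors near `1`
  have hcont : ∀ w : E, Tendsto (fun r : ℝ => modelExp N (r • w)) (𝓝 0) (𝓝 1) := fun w => by
    simpa using (continuous_modelExp_smul (N := N) w).tendsto 0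
  have hev : (fun r : ℝ => idChart E (modelExp N ((s + r) • -x) * modelExp N ((s + r) • (x + y))))
      =ᶠ[𝓝 0] fun r => localMul N (localMul N (idChart E (modelExp N (r • -x)), z),
        idChart E (modelExp N (r • (x + y)))) := by
    have h1 : Tendsto (fun r : ℝ => modelExp N (r • -x) * U) (𝓝 0) (𝓝 U) := by
      simpa using (hcont (-x)).mul_const U
    filter_upwards [(hcont (-x)).eventually (idChartSource_mem_nhds (E := E)),
      (hcont (x + y)).eventually (idChartSource_mem_nhds (E := E)),
      h1.eventually (isOpen_idChartSource.mem_nhds hs)] with r hr1 hr2 hr3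
    rw [← hz, localMul_idChart hr1 hs, localMul_idChart hr3 hr2, add_comm s r,
      modelExp_add_smul, add_comm r s, modelExp_add_smul, hU]
    simp only [mul_assoc]
  have ha : HasDerivAt (fun r : ℝ => (idChart E (modelExp N (r • -x)), z)) (-x, (0 : E)) 0 :=
    (hasDerivAt_idChart_modelExp (N := N) (-x)).prodMk (hasDerivAt_const (0 : ℝ) z)
  have hzero : localMul N ((0 : E), z) = z := by
    have := localMul_idChart (E := E) one_mem_idChartSource hs
    simpa [hz] using this
  have h1 : HasDerivAt (fun r : ℝ => localMul N (idChart E (modelExp N (r • -x)), z))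
      (-(localRight N z x)) 0 := by
    rw [show ((0 : E), z) = (idChart E (modelExp N ((0 : ℝ) • -x)), z) by simp] at hzr
    simpa using! hzr.comp_hasDerivAt (0 : ℝ) ha
  have h2 := h1.prodMk (hasDerivAt_idChart_modelExp (N := N) (x + y))
  have h3 : HasDerivAt (fun r : ℝ => localMul N (localMul N (idChart E (modelExp N (r • -x)), z),
      idChart E (modelExp N (r • (x + y))))) (-(localRight N z x) + localLeft N z (x + y)) 0 := by
    rw [show (z, (0 : E)) = (localMul N (idChart E (modelExp N ((0 : ℝ) • -x)), z),
      idChart E (modelExp N ((0 : ℝ) • (x + y)))) by simp [hzero]] at hzl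
    simpa using! hzl.comp_hasDerivAt (0 : ℝ) h2
  have h4 := h3.congr_of_eventuallyEq hev
  rw [← sub_self s] at h4
  have h5 := h4.comp_sub_const s s
  simp only [add_sub_cancel] at h5
  convert h5 using 1
  simp
  abel

/-- The exponential map is differentiable, with left-trivialised derivative
`(1 - exp (-ad x)) / ad x` at `x`. -/
theorem hasFDerivAt_idChart_exp [FiniteDimensional ℝ E] {F : ℕ → Submodule ℝ E} {n : ℕ}
    (h : IsNilpotentBracket (chartBracket E N) F n) (hn : 1 ≤ n) (x : E) :
    (∀ᶠ y in 𝓝 (0 : E), (modelExp N x)⁻¹ * modelExp N (x + y) ∈ idChartSource E N) ∧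
    HasFDerivAt (fun y : E => idChart E ((modelExp N x)⁻¹ * modelExp N (x + y)))
      (dexp (chartBracket E N) n x) 0 := by
  have := FiniteDimensional.complete ℝ E
  have hT2 := t2Space_of_lieGroup E N
  have := topologicalGroup_of_lieGroup 𝓘(ℝ, E) ∞ (G := N)
  obtain ⟨M, hM, hest⟩ := h.dexp_estimate hn (K := fun z => localLeft N z - localRight N z)
    (C := localLeft N) (by simp [localLeft_zero, localRight_zero])
    (hasFDerivAt_localLeft_sub_localRight N) (contDiffAt_localLeft N).continuousAt
    (localLeft_zero N) x
  have key : ∀ ε > 0, ∀ᶠ y in 𝓝 (0 : E),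
      (modelExp N x)⁻¹ * modelExp N (x + y) ∈ idChartSource E N ∧
      ‖idChart E ((modelExp N x)⁻¹ * modelExp N (x + y)) - dexp (chartBracket E N) n x y‖
        ≤ ε * ‖y‖ := by
    intro ε hε
    obtain ⟨r, hr, hest⟩ := hest ε hε
    obtain ⟨r₀, hr₀, hball⟩ := Metric.eventually_nhds_iff_ball.1
      ((hasDerivAt_idChart_exp_mul_exp (E := E) (N := N)).and
        (eventually_idChart_idChartSymm (N := N)))
    set ρ : ℝ := min r r₀ with hρ
    have hρ0 : 0 < ρ := lt_min hr hr₀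
    have hysmall : ∀ᶠ y in 𝓝 (0 : E), M * ‖y‖ < ρ := by
      have : Tendsto (fun y : E => M * ‖y‖) (𝓝 0) (𝓝 0) := by
        have h : Continuous fun y : E => M * ‖y‖ := by fun_prop
        simpa using h.tendsto 0
      exact this.eventually (gt_mem_nhds hρ0)
    filter_upwards [hysmall] with y hy
    set U : ℝ → N := fun s => modelExp N (s • -x) * modelExp N (s • (x + y)) with hU
    have hUc : Continuous U := (continuous_modelExp_smul _).mul (continuous_modelExp_smul _)
    have hU0 : U 0 = 1 := by simp [hU]
    set O : Set N := idChartSource E N ∩ idChart E ⁻¹' Metric.ball 0 ρ with hO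
    have hcontOn : ContinuousOn (idChart E : N → E) (idChartSource E N) :=
      fun g hg => (continuousAt_idChart hg).continuousWithinAt
    have hOo : IsOpen O := hcontOn.isOpen_inter_preimage isOpen_idChartSource Metric.isOpen_ball
    set C : Set N := idChartSymm N '' Metric.closedBall (0 : E) (M * ‖y‖) with hC
    have hCball : ∀ z ∈ Metric.closedBall (0 : E) (M * ‖y‖), z ∈ Metric.ball (0 : E) ρ ∧
        z ∈ Metric.ball (0 : E) r₀ := fun z hz => by
      have : ‖z‖ < ρ := lt_of_le_of_lt (by simpa using hz) hy
      exact ⟨by simpa using this, by simpa using lt_of_lt_of_le this (min_le_right _ _)⟩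
    have hCc : IsClosed C := by
      have : ProperSpace E := FiniteDimensional.proper ℝ E
      refine ((isCompact_closedBall _ _).image_of_continuousOn fun z hz => ?_).isClosed
      exact (contMDiffAt_idChartSymm
        (hball z (hCball z hz).2).2.2.2).continuousAt.continuousWithinAt
    have hCO : C ⊆ O := by
      rintro _ ⟨z, hz, rfl⟩
      obtain ⟨h1, h2, -⟩ := (hball z (hCball z hz).2).2
      refine ⟨h1, ?_⟩
      rw [mem_preimage, h2]
      exact (hCball z hz).1
    have hode : ∀ T ≤ 1, (∀ t ∈ Icc 0 T, U t ∈ O) →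
        (∀ t ∈ Icc 0 T, ‖idChart E (U t)‖ ≤ M * ‖y‖) ∧
        (T = 1 → ‖idChart E (U 1) - dexp (chartBracket E N) n x y‖ ≤ ε * ‖y‖) := by
      intro T hT hUO
      refine hest y (fun s => idChart E (U s)) T hT (by simp [hU0])
        (hcontOn.comp hUc.continuousOn fun t ht => (hUO t ht).1) fun t ht => ?_
      obtain ⟨h1, h2⟩ := hUO t ⟨ht.1, ht.2.le⟩
      have h3 : ‖idChart E (U t)‖ < ρ := by simpa using h2
      refine ⟨h3.le.trans (min_le_left _ _), ?_⟩
      exact (hball (idChart E (U t)) (by simpa using lt_of_lt_of_le h3 (min_le_right _ _))).1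
        x y t h1 rfl
    -- by the a priori bound, the curve cannot leave the domain of the chart
    have hstay := mem_of_forall_Icc_mem hUc hOo hCc hCO
      (by rw [hU0]; exact ⟨one_mem_idChartSource, by simpa using hρ0⟩) fun T hT hUO =>
        ⟨idChart E (U T), by simpa using (hode T hT.2 hUO).1 T ⟨hT.1, le_rfl⟩,
          idChartSymm_idChart (hUO T ⟨hT.1, le_rfl⟩).1⟩
    have hU1 : U 1 = (modelExp N x)⁻¹ * modelExp N (x + y) := by simp [hU, modelExp_neg]
    rw [← hU1]
    exact ⟨(hstay 1 (by simp)).1, (hode 1 le_rfl hstay).2 rfl⟩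
  refine ⟨(key 1 one_pos).mono fun y hy => hy.1, ?_⟩
  rw [hasFDerivAt_iff_isLittleO_nhds_zero, Asymptotics.isLittleO_iff]
  intro ε hε
  filter_upwards [key ε hε] with y hy
  simpa using hy.2

end DerivExp

/-! ### Smoothness of the exponential map -/

section SmoothExp

open Set Filter Topology

variable {E : Type*} [NormedAddCommGroup E] [NormedSpace ℝ E]
  (N : Type*) [TopologicalSpace N] [ChartedSpace E N] [Group N]

/-- The exponential map near `x`, left-translated to the identity and read in the chart there. -/
noncomputable def translatedExp (x y : E) : E :=
  idChart E ((modelExp N x)⁻¹ * modelExp N (x + y))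

variable [LieGroup 𝓘(ℝ, E) ∞ N] {N}
  [FiniteDimensional ℝ E] {F : ℕ → Submodule ℝ E} {n : ℕ}

omit [LieGroup 𝓘(ℝ, E) ∞ N] [FiniteDimensional ℝ E] in
@[simp] theorem translatedExp_zero (x : E) : translatedExp N x 0 = 0 := by simp [translatedExp]

theorem eventually_modelExp_eq (h : IsNilpotentBracket (chartBracket E N) F n) (hn : 1 ≤ n)
    (x : E) : ∀ᶠ x' in 𝓝 x, (modelExp N x)⁻¹ * modelExp N x' ∈ idChartSource E N ∧
      modelExp N x' = modelExp N x * idChartSymm N (translatedExp N x (x' - x)) := by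
  have ht : Tendsto (fun x' : E => x' - x) (𝓝 x) (𝓝 0) := by
    have h : Continuous fun x' : E => x' - x := by fun_prop
    simpa using h.tendsto x
  filter_upwards [ht.eventually (hasFDerivAt_idChart_exp h hn x).1] with x' hx'
  rw [add_sub_cancel] at hx'
  refine ⟨hx', ?_⟩
  rw [translatedExp, add_sub_cancel, idChartSymm_idChart hx', mul_inv_cancel_left]

theorem continuous_modelExp (h : IsNilpotentBracket (chartBracket E N) F n) (hn : 1 ≤ n) :
    Continuous (modelExp N : E → N) := by
  have := topologicalGroup_of_lieGroup 𝓘(ℝ, E) ∞ (G := N)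
  rw [continuous_iff_continuousAt]
  intro x
  have h1 : ContinuousAt (fun x' : E => translatedExp N x (x' - x)) x :=
    ContinuousAt.comp (f := fun x' : E => x' - x) (g := translatedExp N x)
      (by simpa using! (hasFDerivAt_idChart_exp h hn x).2.continuousAt) (by fun_prop)
  have h2 : ContinuousAt (fun x' : E => idChartSymm N (translatedExp N x (x' - x))) x :=
    ContinuousAt.comp (f := fun x' : E => translatedExp N x (x' - x)) (g := idChartSymm N)
      (by simpa using (contMDiffAt_idChartSymm_zero (E := E) (N := N)).continuousAt) h1
  exact (continuousAt_const.mul h2).congr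
    ((eventually_modelExp_eq h hn x).mono fun x' hx' => hx'.2.symm)

/-- The derivative of `translatedExp` at points near `0` is that of `exp` at `x + y`, moved by a
left translation. -/
theorem eventually_hasFDerivAt_translatedExp (h : IsNilpotentBracket (chartBracket E N) F n)
    (hn : 1 ≤ n) (x : E) : ∀ᶠ y in 𝓝 (0 : E), HasFDerivAt (translatedExp N x)
      (localLeft N (translatedExp N x y) ∘L dexp (chartBracket E N) n (x + y)) y := by
  have hc : Tendsto (translatedExp N x) (𝓝 0) (𝓝 0) := by
    simpa using! (hasFDerivAt_idChart_exp h hn x).2.continuousAt.tendsto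
  filter_upwards [(hasFDerivAt_idChart_exp h hn x).1,
    hc.eventually (eventually_hasFDerivAt_localMul_left N)] with y hy hyd
  obtain ⟨hsrc, hd⟩ := hasFDerivAt_idChart_exp h hn (x + y)
  have hev : (fun k => translatedExp N x (y + k)) =ᶠ[𝓝 0]
      fun k => localMul N (translatedExp N x y, translatedExp N (x + y) k) := by
    filter_upwards [hsrc] with k hk
    rw [translatedExp, translatedExp, translatedExp, localMul_idChart hy hk, ← add_assoc]
    congr 1
    group
  have h1 : HasFDerivAt (fun k => (translatedExp N x y, translatedExp N (x + y) k)) _ (0 : E) :=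
    (hasFDerivAt_const (translatedExp N x y) (0 : E)).prodMk hd
  rw [show (translatedExp N x y, (0 : E)) = (translatedExp N x y, translatedExp N (x + y) 0)
    by simp] at hyd
  have h2 := (hyd.comp (0 : E) h1).congr_of_eventuallyEq hev
  rw [← sub_self y] at h2
  have h3 := h2.comp (f := fun z => z - y) y ((hasFDerivAt_id y).sub_const y)
  simp only [Function.comp_def, add_sub_cancel] at h3
  convert! h3 using 1
  ext v
  simp

/-- Smoothness by bootstrapping: the derivative of `translatedExp` is a smooth function of the point
and of the value of `translatedExp` there. -/
theorem contDiffAt_translatedExp (h : IsNilpotentBracket (chartBracket E N) F n)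
    (hn : 1 ≤ n) (x : E) : ContDiffAt ℝ ∞ (translatedExp N x) 0 := by
  have hev := eventually_hasFDerivAt_translatedExp h hn x
  rw [contDiffAt_infty]
  intro k
  induction k with
  | zero =>
    rw [Nat.cast_zero, contDiffAt_zero]
    exact ⟨_, hev, fun y hy => HasFDerivAt.continuousAt hy |>.continuousWithinAt⟩
  | succ k ih =>
    rw [Nat.cast_succ, contDiffAt_succ_iff_hasFDerivAt]
    refine ⟨_, ⟨_, hev, fun y hy => hy⟩, ?_⟩
    have h1 : ContDiffAt ℝ k (fun y => localLeft N (translatedExp N x y)) 0 :=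
      ContDiffAt.comp (0 : E) (g := localLeft N)
        (by simpa using (contDiffAt_localLeft N).of_le (by exact_mod_cast le_top)) ih
    have h2 : ContDiffAt ℝ k (fun y => dexp (chartBracket E N) n (x + y)) 0 :=
      (((contDiff_dexp (chartBracket E N) n).comp (contDiff_const.add contDiff_id)).of_le
        (by exact_mod_cast le_top)).contDiffAt
    exact h1.clm_comp h2

theorem hasStrictFDerivAt_translatedExp (h : IsNilpotentBracket (chartBracket E N) F n)
    (hn : 1 ≤ n) (x : E) :
    HasStrictFDerivAt (translatedExp N x) (h.dexpEquiv hn x : E →L[ℝ] E) 0 := by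
  rw [h.coe_dexpEquiv hn x]
  exact (contDiffAt_translatedExp h hn x).hasStrictFDerivAt' (hasFDerivAt_idChart_exp h hn x).2
    (by simp)

theorem contMDiff_modelExp (h : IsNilpotentBracket (chartBracket E N) F n) (hn : 1 ≤ n) :
    ContMDiff 𝓘(ℝ, E) 𝓘(ℝ, E) ∞ (modelExp N : E → N) := by
  intro x
  have h1 : ContDiffAt ℝ ∞ (fun x' : E => translatedExp N x (x' - x)) x :=
    ContDiffAt.comp (f := fun x' : E => x' - x) (g := translatedExp N x) x
      (by simpa using contDiffAt_translatedExp h hn x) (contDiff_id.sub contDiff_const).contDiffAt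
  have h2 : ContMDiffAt 𝓘(ℝ, E) 𝓘(ℝ, E) ∞
      (fun x' : E => idChartSymm N (translatedExp N x (x' - x))) x :=
    ContMDiffAt.comp (f := fun x' : E => translatedExp N x (x' - x)) (g := idChartSymm N) x
      (by simpa using contMDiffAt_idChartSymm_zero (E := E) (N := N)) h1.contMDiffAt
  have h3 : ContMDiffAt 𝓘(ℝ, E) 𝓘(ℝ, E) ∞
      (fun x' : E => modelExp N x * idChartSymm N (translatedExp N x (x' - x))) x :=
    contMDiffAt_const.mul h2
  exact h3.congr_of_eventuallyEq ((eventually_modelExp_eq h hn x).mono fun x' hx' => hx'.2)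

theorem isOpenMap_modelExp (h : IsNilpotentBracket (chartBracket E N) F n) (hn : 1 ≤ n) :
    IsOpenMap (modelExp N : E → N) := by
  have := FiniteDimensional.complete ℝ E
  have := topologicalGroup_of_lieGroup 𝓘(ℝ, E) ∞ (G := N)
  rw [isOpenMap_iff_nhds_le]
  intro x
  -- near `exp x`, the point `g` is determined by the coordinate of `(exp x)⁻¹ * g`
  have hg : Tendsto (fun g : N => idChart E ((modelExp N x)⁻¹ * g)) (𝓝 (modelExp N x)) (𝓝 0) := by
    have h1 : ContinuousAt (fun g : N => (modelExp N x)⁻¹ * g) (modelExp N x) := by fun_prop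
    have h2 : ContinuousAt (idChart E : N → E) ((modelExp N x)⁻¹ * modelExp N x) :=
      continuousAt_idChart (by simpa using one_mem_idChartSource)
    simpa using! ContinuousAt.comp (f := fun g : N => (modelExp N x)⁻¹ * g) h2 h1 |>.tendsto
  have hmap : map (translatedExp N x) (𝓝 0) = 𝓝 0 := by
    simpa using (hasStrictFDerivAt_translatedExp h hn x).map_nhds_eq_of_equiv
  intro S hS
  rw [mem_map] at hS
  have hx : map (fun y : E => x + y) (𝓝 0) = 𝓝 x := by simp
  rw [← hx, mem_map] at hS
  have hT : translatedExp N x '' ((fun y : E => x + y) ⁻¹' (modelExp N ⁻¹' S) ∩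
      {y | (modelExp N x)⁻¹ * modelExp N (x + y) ∈ idChartSource E N}) ∈ 𝓝 (0 : E) := by
    rw [← hmap]
    exact image_mem_map (inter_mem hS (hasFDerivAt_idChart_exp h hn x).1)
  have hsrc : ∀ᶠ g in 𝓝 (modelExp N x), (modelExp N x)⁻¹ * g ∈ idChartSource E N := by
    have h1 : ContinuousAt (fun g : N => (modelExp N x)⁻¹ * g) (modelExp N x) := by fun_prop
    exact h1.eventually (by simpa using idChartSource_mem_nhds)
  filter_upwards [hg.eventually hT, hsrc] with g hg hgs
  obtain ⟨y, ⟨hyS, hysrc⟩, hy⟩ := hg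
  have h3 : (modelExp N x)⁻¹ * modelExp N (x + y) = (modelExp N x)⁻¹ * g := by
    rw [← idChartSymm_idChart hysrc, ← idChartSymm_idChart hgs, ← hy, translatedExp]
  rw [← mul_left_cancel h3]
  exact hyS

theorem isLocallyInjective_modelExp (h : IsNilpotentBracket (chartBracket E N) F n) (hn : 1 ≤ n) :
    IsLocallyInjective (modelExp N : E → N) := by
  have := FiniteDimensional.complete ℝ E
  rw [isLocallyInjective_iff_nhds]
  intro x
  have h0 := hasStrictFDerivAt_translatedExp h hn x
  refine ⟨(fun y => y - x) ⁻¹' (h0.toOpenPartialHomeomorph (translatedExp N x)).source, ?_, ?_⟩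
  · have hc : ContinuousAt (fun y : E => y - x) x := by fun_prop
    exact hc.preimage_mem_nhds (by simpa using h0.mem_toOpenPartialHomeomorph_source |>
      (h0.toOpenPartialHomeomorph (translatedExp N x)).open_source.mem_nhds)
  · intro a ha b hb hab
    have h1 : translatedExp N x (a - x) = translatedExp N x (b - x) := by
      simp only [translatedExp, add_sub_cancel, hab]
    exact sub_left_injective ((h0.toOpenPartialHomeomorph (translatedExp N x)).injOn ha hb h1)

/-- If the exponential map is bijective, its inverse is smooth: near `exp x` it is the inverse
function of `translatedExp` composed with a chart. -/
theorem exists_diffeomorph_modelExp (h : IsNilpotentBracket (chartBracket E N) F n) (hn : 1 ≤ n)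
    (hbij : Function.Bijective (modelExp N : E → N)) :
    ∃ Φ : E ≃ₘ⟮𝓘(ℝ, E), 𝓘(ℝ, E)⟯ N, ∀ x, Φ x = modelExp N x := by
  have := FiniteDimensional.complete ℝ E
  have := topologicalGroup_of_lieGroup 𝓘(ℝ, E) ∞ (G := N)
  let e := Equiv.ofBijective _ hbij
  have hec : Continuous e.symm :=
    (e.toHomeomorphOfContinuousOpen (continuous_modelExp h hn)
      (isOpenMap_modelExp h hn)).symm.continuous
  refine ⟨⟨e, contMDiff_modelExp h hn, fun g => ?_⟩, fun x => rfl⟩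
  obtain ⟨x, rfl⟩ := hbij.2 g
  have hex : e.symm (modelExp N x) = x := e.left_inv x
  have hd := contDiffAt_translatedExp h hn x
  have hd' : HasFDerivAt (translatedExp N x) (h.dexpEquiv hn x : E →L[ℝ] E) 0 :=
    (hasStrictFDerivAt_translatedExp h hn x).hasFDerivAt
  have hinv := hd.to_localInverse hd' (by simp)
  rw [translatedExp_zero] at hinv
  have h1 : ContMDiffAt 𝓘(ℝ, E) 𝓘(ℝ, E) ∞ (fun g : N => idChart E ((modelExp N x)⁻¹ * g))
      (modelExp N x) :=
    ContMDiffAt.comp (g := idChart E) (f := fun g : N => (modelExp N x)⁻¹ * g) (modelExp N x)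
      (contMDiffAt_idChart (by simpa using one_mem_idChartSource)) contMDiff_mul_left.contMDiffAt
  have h2 : ContMDiffAt 𝓘(ℝ, E) 𝓘(ℝ, E) ∞ (fun g : N =>
      x + hd.localInverse hd' (by simp) (idChart E ((modelExp N x)⁻¹ * g))) (modelExp N x) := by
    refine ContMDiffAt.comp (g := fun z : E => x + hd.localInverse hd' (by simp) z)
      (f := fun g : N => idChart E ((modelExp N x)⁻¹ * g)) (modelExp N x) ?_ h1
    rw [inv_mul_cancel, idChart_one]
    exact (contDiffAt_const.add hinv).contMDiffAt
  refine h2.congr_of_eventuallyEq ?_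
  have hleft : ∀ᶠ y in 𝓝 (0 : E), hd.localInverse hd' (by simp) (translatedExp N x y) = y :=
    (hasStrictFDerivAt_translatedExp h hn x).eventually_left_inverse
  have ht : Tendsto (fun g : N => e.symm g - x) (𝓝 (modelExp N x)) (𝓝 0) := by
    have : Continuous fun g : N => e.symm g - x := hec.sub continuous_const
    simpa [hex] using this.tendsto (modelExp N x)
  filter_upwards [ht.eventually hleft] with g hg
  have hgg : modelExp N (e.symm g) = g := e.right_inv g
  rw [translatedExp, add_sub_cancel, hgg] at hg
  rw [hg, add_sub_cancel]

end SmoothExp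

/-! ### The exponential map is a bijective homomorphism -/

section Product

open Set Filter Topology

variable {E : Type*} [NormedAddCommGroup E] [NormedSpace ℝ E] [FiniteDimensional ℝ E]
  {N : Type*} [TopologicalSpace N] [ChartedSpace E N] [Group N] [LieGroup 𝓘(ℝ, E) ∞ N]
  {F : ℕ → Submodule ℝ E} {n : ℕ}

/-- The exponential map turns the Campbell–Hausdorff product into the product of the group: both
`t ↦ exp x * exp (t • y)` and the exponential of the Campbell–Hausdorff flow are integral curves of
the left-invariant field of `y`. -/
theorem modelExp_mul_modelExp (h : IsNilpotentBracket (chartBracket E N) F n) (hn : 1 ≤ n)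
    (x y : E) : modelExp N x * modelExp N y = modelExp N (bchMul (chartBracket E N) n x y) := by
  have := FiniteDimensional.complete ℝ E
  set Z : ℝ → E := fun t => bchFlow (chartBracket E N) n t (x, y) with hZ
  have hZd : ∀ t, HasDerivAt Z (dexpInv (chartBracket E N) n (Z t) y) t :=
    h.hasDerivAt_bchFlow hn (x, y)
  have hcurve : IsMIntegralCurve (fun t => modelExp N (Z t)) (leftField N y) := by
    intro t
    refine hasMFDerivAt_of_idChart
      ((continuous_modelExp h hn).continuousAt.comp (hZd t).continuousAt) ?_
    have h1 : HasFDerivAt (translatedExp N (Z t)) (dexp (chartBracket E N) n (Z t))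
        (Z t - Z t) := by
      rw [sub_self]
      exact (hasFDerivAt_idChart_exp h hn (Z t)).2
    have h2 := h1.comp_hasDerivAt t ((hZd t).sub_const (Z t))
    rw [h.dexp_dexpInv hn] at h2
    simpa only [Function.comp_def, translatedExp, add_sub_cancel] using! h2
  have h3 := isMIntegralCurve_leftField_eq hcurve 1
  rw [one_smul] at h3
  rw [show bchMul (chartBracket E N) n x y = Z 1 from rfl]
  have hZ0 : Z 0 = x := bchFlow_zero_time _ _ _
  rw [← hZ0]
  exact h3.symm

/-- Maps into the model space with the same exponential agree as soon as they agree at a point. -/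
theorem eq_of_modelExp_eq (h : IsNilpotentBracket (chartBracket E N) F n) (hn : 1 ≤ n)
    {A : Type*} [TopologicalSpace A] [PreconnectedSpace A] {f g : A → E} (hf : Continuous f)
    (hg : Continuous g) (hfg : ∀ a, modelExp N (f a) = modelExp N (g a)) (a₀ : A)
    (h0 : f a₀ = g a₀) (a : A) : f a = g a :=
  congrFun ((T2Space.isSeparatedMap (modelExp N : E → N)).eq_of_comp_eq
    (isLocallyInjective_modelExp h hn) hf hg (funext hfg) a₀ h0) a

/-- Both sides have the same exponential, by associativity in `N`. -/
theorem bchMul_assoc (h : IsNilpotentBracket (chartBracket E N) F n) (hn : 1 ≤ n) (x y z : E) :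
    bchMul (chartBracket E N) n (bchMul (chartBracket E N) n x y) z =
      bchMul (chartBracket E N) n x (bchMul (chartBracket E N) n y z) := by
  have hc := continuous_bchMul (chartBracket E N) n
  refine eq_of_modelExp_eq h hn (A := E × E × E)
    (f := fun v => bchMul (chartBracket E N) n (bchMul (chartBracket E N) n v.1 v.2.1) v.2.2)
    (g := fun v => bchMul (chartBracket E N) n v.1 (bchMul (chartBracket E N) n v.2.1 v.2.2))
    ?_ ?_ (fun v => ?_) (0, 0, 0) ?_ (x, y, z)
  · exact hc.comp ((hc.comp (continuous_fst.prodMk (continuous_fst.comp continuous_snd))).prodMk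
      (continuous_snd.comp continuous_snd))
  · exact hc.comp (continuous_fst.prodMk (hc.comp continuous_snd))
  · simp only [← modelExp_mul_modelExp h hn, mul_assoc]
  · simp [h.bchMul_zero hn]

theorem neg_bchMul_self (h : IsNilpotentBracket (chartBracket E N) F n) (hn : 1 ≤ n) (x : E) :
    bchMul (chartBracket E N) n (-x) x = 0 := by
  have := FiniteDimensional.complete ℝ E
  refine eq_of_modelExp_eq h hn (f := fun x => bchMul (chartBracket E N) n (-x) x)
    (g := fun _ => 0) ?_ continuous_const (fun x => ?_) 0 (by simp [h.bchMul_zero hn]) x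
  · exact (continuous_bchMul (chartBracket E N) n).comp (continuous_neg.prodMk continuous_id)
  · rw [← modelExp_mul_modelExp h hn, modelExp_neg, inv_mul_cancel, modelExp_zero]

/-- The model space with the Campbell–Hausdorff product. -/
@[reducible] noncomputable def bchGroup
    (h : IsNilpotentBracket (chartBracket E N) F n) (hn : 1 ≤ n) : Group E where
  mul := bchMul (chartBracket E N) n
  mul_assoc := bchMul_assoc h hn
  one := 0
  one_mul := h.zero_bchMul hn
  mul_one := h.bchMul_zero hn
  inv x := -x
  inv_mul_cancel := neg_bchMul_self h hn

/-- The exponential map is a surjective homomorphism with discrete kernel for the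
Campbell–Hausdorff product, hence a covering map, hence injective if the group is simply
connected. -/
theorem bijective_modelExp [SimplyConnectedSpace N]
    (h : IsNilpotentBracket (chartBracket E N) F n) (hn : 1 ≤ n) :
    Function.Bijective (modelExp N : E → N) := by
  have := FiniteDimensional.complete ℝ E
  have := topologicalGroup_of_lieGroup 𝓘(ℝ, E) ∞ (G := N)
  have := ChartedSpace.locallyPathConnectedSpace E N
  let _ : Group E := bchGroup h hn
  have : IsTopologicalGroup E :=
    { continuous_mul := continuous_bchMul (chartBracket E N) n
      continuous_inv := continuous_neg }
  let f : E →* N :=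
    { toFun := modelExp N
      map_one' := modelExp_zero
      map_mul' := fun x y => (modelExp_mul_modelExp h hn x y).symm }
  have hopen : IsOpenMap f := isOpenMap_modelExp h hn
  have hcont : Continuous f := continuous_modelExp h hn
  -- an open subgroup of a connected group is everything
  have hsurj : Function.Surjective f := by
    have hro : IsOpen (f.range : Set N) := by
      rw [MonoidHom.coe_range]
      exact hopen.isOpen_range
    have hcl : IsClopen (f.range : Set N) := ⟨f.range.isClosed_of_isOpen hro, hro⟩
    have huniv := hcl.eq_univ ⟨1, f.range.one_mem⟩
    rw [MonoidHom.coe_range] at huniv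
    exact range_eq_univ.1 huniv
  have hdisc : IsDiscrete (f.ker : Set E) := by
    refine IsDiscrete.of_nhdsWithin fun x hx => ?_
    obtain ⟨U, hU, hxU, hinj⟩ := isLocallyInjective_modelExp h hn x
    rw [le_pure_iff]
    refine mem_nhdsWithin.2 ⟨U, hU, hxU, fun y hy => ?_⟩
    exact hinj hy.1 hxU (Eq.trans (f.mem_ker.1 hy.2) (f.mem_ker.1 hx).symm)
  have hcov : IsCoveringMap f :=
    ((hopen.isQuotientMap hcont hsurj).isQuotientCoveringMap_of_isDiscrete_ker_monoidHom
      hdisc).isCoveringMap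
  -- the identity of the simply connected group lifts to a section of the covering, which is also a
  -- left inverse
  obtain ⟨s, ⟨hs0, hs⟩, -⟩ := hcov.existsUnique_continuousMap_lifts (ContinuousMap.id N)
    1 (0 : E) modelExp_zero
  refine ⟨fun x y hxy => ?_, hsurj⟩
  have hleft : ∀ x : E, s (f x) = x := eq_of_modelExp_eq h hn (s.continuous.comp hcont)
    continuous_id (fun x => congrFun hs (f x)) 0
    ((congrArg s (modelExp_zero (E := E) (N := N))).trans hs0)
  rw [← hleft x, ← hleft y]
  exact congrArg s hxy

end Product

/-! ### Graded coordinates -/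

section GradedCoordinates

variable {E : Type*} [AddCommGroup E] [Module ℝ E] {R : ℕ → Submodule ℝ E} {n : ℕ}

/-- The component of degree `k` of a vector, for an internal direct sum. -/
noncomputable def gradedProj (hint : DirectSum.IsInternal R) (k : ℕ) : E →ₗ[ℝ] R k :=
  DirectSum.component ℝ ℕ (fun k => R k) k ∘ₗ
    (LinearEquiv.ofBijective (DirectSum.coeLinearMap R) hint).symm.toLinearMap

theorem gradedProj_coe (hint : DirectSum.IsInternal R) {k j : ℕ} (x : R j) :
    ((gradedProj hint k x : R k) : E) = if k = j then (x : E) else 0 := by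
  have h : (LinearEquiv.ofBijective (DirectSum.coeLinearMap R) hint).symm x =
      DirectSum.lof ℝ ℕ (fun k => R k) j x := by
    rw [LinearEquiv.symm_apply_eq]
    exact (DirectSum.coeLinearMap_lof R j x).symm
  rw [gradedProj, LinearMap.comp_apply, LinearEquiv.coe_coe, h]
  by_cases hk : k = j
  · subst hk
    rw [if_pos rfl, DirectSum.component.lof_self]
  · rw [if_neg hk, DirectSum.component.of, dif_neg (Ne.symm hk)]
    rfl

theorem eq_of_gradedProj_eq (hint : DirectSum.IsInternal R) {x y : E}
    (h : ∀ k, gradedProj hint k x = gradedProj hint k y) : x = y := by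
  apply (LinearEquiv.ofBijective (DirectSum.coeLinearMap R) hint).symm.injective
  exact DFinsupp.ext h

/-- A finite sum of homogeneous vectors of distinct degrees has the expected components. -/
theorem gradedProj_sum (hint : DirectSum.IsInternal R) (s : Finset ℕ) (a : ∀ k, R k) {k : ℕ}
    (hk : k ∈ s ∨ R k = ⊥) : gradedProj hint k (∑ j ∈ s, (a j : E)) = a k := by
  rw [map_sum]
  apply Subtype.ext
  rw [AddSubmonoidClass.coe_finsetSum]
  simp only [gradedProj_coe]
  rw [Finset.sum_ite_eq]
  split_ifs with hks
  · rfl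
  · have : (a k : E) ∈ (⊥ : Submodule ℝ E) := (hk.resolve_left hks) ▸ (a k).2
    exact ((Submodule.mem_bot ℝ).1 this).symm

theorem mem_Icc_or_eq_bot (h0 : R 0 = ⊥) (hbig : ∀ k, n < k → R k = ⊥) (k : ℕ) :
    k ∈ Finset.Icc 1 n ∨ R k = ⊥ := by
  rcases Nat.eq_zero_or_pos k with rfl | hk
  · exact Or.inr h0
  · rcases le_or_gt k n with hkn | hkn
    · exact Or.inl (Finset.mem_Icc.2 ⟨hk, hkn⟩)
    · exact Or.inr (hbig k hkn)

theorem sum_gradedProj (hint : DirectSum.IsInternal R) (h0 : R 0 = ⊥)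
    (hbig : ∀ k, n < k → R k = ⊥) (x : E) :
    ∑ k ∈ Finset.Icc 1 n, (gradedProj hint k x : E) = x :=
  eq_of_gradedProj_eq hint fun k =>
    gradedProj_sum hint _ (fun k => gradedProj hint k x) (mem_Icc_or_eq_bot h0 hbig k)

theorem bijective_graded_sum (hint : DirectSum.IsInternal R) (h0 : R 0 = ⊥)
    (hbig : ∀ k, n < k → R k = ⊥) :
    Function.Bijective fun a : ∀ k, R k => ∑ k ∈ Finset.Icc 1 n, (a k : E) := by
  refine ⟨fun a b hab => funext fun k => ?_,
    fun x => ⟨fun k => gradedProj hint k x, sum_gradedProj hint h0 hbig x⟩⟩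
  have hk := mem_Icc_or_eq_bot h0 hbig k
  rw [← gradedProj_sum hint _ a hk, ← gradedProj_sum hint _ b hk]
  exact congrArg _ hab

/-- The filtration term `F i` contains the vectors without components of degree at most `i`. -/
theorem mem_of_gradedProj_eq_zero (hint : DirectSum.IsInternal R) (h0 : R 0 = ⊥)
    (hbig : ∀ k, n < k → R k = ⊥) {F : ℕ → Submodule ℝ E} (hF : Antitone F)
    (hsup : ∀ k, R (k + 1) ⊔ F (k + 1) = F k) {i : ℕ} {x : E}
    (hx : ∀ k ≤ i, gradedProj hint k x = 0) : x ∈ F i := by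
  rw [← sum_gradedProj hint h0 hbig x]
  refine Submodule.sum_mem _ fun k _ => ?_
  rcases le_or_gt k i with hk | hk
  · simp [hx k hk]
  · obtain ⟨j, rfl⟩ : ∃ j, k = j + 1 := ⟨k - 1, by omega⟩
    have : R (j + 1) ≤ F i := (le_sup_left.trans (hsup j).le).trans (hF (by omega))
    exact this (gradedProj hint (j + 1) x).2

theorem gradedProj_eq_zero_of_mem (hint : DirectSum.IsInternal R)
    {F : ℕ → Submodule ℝ E} (hbot : ∀ k, n ≤ k → F k = ⊥)
    (hsup : ∀ k, R (k + 1) ⊔ F (k + 1) = F k) {k i : ℕ} (hki : k ≤ i) {x : E} (hx : x ∈ F i) :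
    gradedProj hint k x = 0 := by
  suffices h : ∀ m i, n ≤ i + m → k ≤ i → F i ≤ LinearMap.ker (gradedProj hint k) from
    h n i (by omega) hki hx
  intro m
  induction m with
  | zero =>
    intro i hi _
    rw [hbot i (by omega)]
    exact bot_le
  | succ m ih =>
    intro i hi hki
    rw [← hsup i]
    refine sup_le (fun y hy => ?_) (ih (i + 1) (by omega) (by omega))
    have := gradedProj_coe hint (k := k) (⟨y, hy⟩ : R (i + 1))
    rw [if_neg (by omega)] at this
    exact Subtype.ext this

/-- The vector with given components of degree less than `k`. -/
def lowerSum (R : ℕ → Submodule ℝ E) (k : ℕ) : LowerCoordinates R k →ₗ[ℝ] E :=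
  ∑ j : Set.Iio k, (R j).subtype ∘ₗ LinearMap.proj j

theorem lowerSum_lowerCoordinates (a : ∀ k, R k) (k : ℕ) :
    lowerSum R k (lowerCoordinates a k) = ∑ j ∈ Finset.range k, (a j : E) := by
  rw [lowerSum, LinearMap.sum_apply]
  exact (Finset.sum_subtype (Finset.range k) (p := (· ∈ Set.Iio k)) (by simp)
    (fun j => (a j : E))).symm

end GradedCoordinates

/-- In the coordinates of a grading compatible with the filtration, the Campbell–Hausdorff product
is triangular: its component of degree `k` is `a k + b k` plus a polynomial in the components of
lower degree. -/
theorem IsNilpotentBracket.exists_graded_bchMul {E : Type*} [NormedAddCommGroup E]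
    [NormedSpace ℝ E] [FiniteDimensional ℝ E] {β : E →L[ℝ] E →L[ℝ] E} {F R : ℕ → Submodule ℝ E}
    {n : ℕ} (h : IsNilpotentBracket β F n) (hn : 1 ≤ n) (hint : DirectSum.IsInternal R)
    (h0 : R 0 = ⊥) (hbig : ∀ k, n < k → R k = ⊥) (hsup : ∀ k, R (k + 1) ⊔ F (k + 1) = F k) :
    ∃ p : ∀ k, LowerCoordinates R k → LowerCoordinates R k → R k,
      (∀ k, IsPolynomialMap (fun ab : LowerCoordinates R k × LowerCoordinates R k =>
        p k ab.1 ab.2)) ∧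
      (∀ k a, p k a 0 = 0) ∧ (∀ k b, p k 0 b = 0) ∧
      (∀ a b, p 1 a b = 0) ∧
      ∀ a b : ∀ k, R k,
        bchMul β n (∑ k ∈ Finset.Icc 1 n, (a k : E)) (∑ k ∈ Finset.Icc 1 n, (b k : E)) =
          ∑ k ∈ Finset.Icc 1 n,
            ((a k + b k + p k (lowerCoordinates a k) (lowerCoordinates b k) : R k) : E) := by
  -- `p k` is the component of degree `k` of the correction term, with all components of degree at
  -- least `k` of the arguments set to zero
  let P : E → E → E := fun x y => bchMul β n x y - x - y
  refine ⟨fun k a b => gradedProj hint k (P (lowerSum R k a) (lowerSum R k b)),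
    fun k => ?_, fun k a => ?_, fun k b => ?_, fun a b => ?_, fun a b => ?_⟩
  · have hP : IsPolynomialMap fun v : E × E => P v.1 v.2 :=
      ((isPolynomialMap_bchMul β n).sub (IsPolynomialMap.of_linear (LinearMap.fst ℝ E E))).sub
        (IsPolynomialMap.of_linear (LinearMap.snd ℝ E E))
    exact (hP.comp_linear ((lowerSum R k).prodMap (lowerSum R k))).linear_comp (gradedProj hint k)
  · simp [P, h.bchMul_zero hn]
  · simp [P, h.zero_bchMul hn]
  · -- the only lower coordinate is the one of degree `0`, which vanishes
    have hz : ∀ a : LowerCoordinates R 1, lowerSum R 1 a = 0 := fun a => by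
      rw [lowerSum, LinearMap.sum_apply]
      refine Finset.sum_eq_zero fun j _ => ?_
      have hj : (j : ℕ) = 0 := by
        have := j.2
        simp only [Set.mem_Iio] at this
        omega
      have : (a j : E) ∈ (⊥ : Submodule ℝ E) := by
        rw [← h0, ← hj]
        exact (a j).2
      simpa using this
    simp [P, hz, h.bchMul_zero hn]
  · set x := ∑ k ∈ Finset.Icc 1 n, (a k : E) with hx
    set y := ∑ k ∈ Finset.Icc 1 n, (b k : E) with hy
    refine eq_of_gradedProj_eq hint fun k => ?_
    have hk := mem_Icc_or_eq_bot h0 hbig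
    rw [gradedProj_sum hint _ (fun k => a k + b k +
      gradedProj hint k (P (lowerSum R k (lowerCoordinates a k))
        (lowerSum R k (lowerCoordinates b k)))) (hk k)]
    have hxk := gradedProj_sum hint _ a (hk k)
    have hyk := gradedProj_sum hint _ b (hk k)
    rw [← hx] at hxk
    rw [← hy] at hyk
    have hsplit : bchMul β n x y = x + y + P x y := by simp only [P]; abel
    rw [hsplit, map_add, map_add, hxk, hyk]
    congr 1
    rcases Nat.eq_zero_or_pos k with rfl | hkpos
    · have : Subsingleton (R 0) := by rw [h0]; infer_instance
      exact Subsingleton.elim _ _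
    obtain ⟨i, rfl⟩ : ∃ i, k = i + 1 := ⟨k - 1, by omega⟩
    have hlow : ∀ (c : ∀ k, R k), ∑ k ∈ Finset.Icc 1 n, (c k : E) -
        lowerSum R (i + 1) (lowerCoordinates c (i + 1)) ∈ F i := fun c => by
      refine mem_of_gradedProj_eq_zero hint h0 hbig h.anti hsup fun j hj => ?_
      rw [map_sub, gradedProj_sum hint _ c (hk j), lowerSum_lowerCoordinates,
        gradedProj_sum hint _ c (Or.inl (Finset.mem_range.2 (by omega))), sub_self]
    have hmem := h.bchMul_sub_mem hn (hlow a) (hlow b)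
    have := gradedProj_eq_zero_of_mem hint (fun k hk => h.eq_bot_of_le hk) hsup le_rfl hmem
    rwa [map_sub, sub_eq_zero] at this

/-! ### Conclusion -/

/-- The lower central series of the Lie algebra of a Lie group, as a filtration of the model space;
the index is shifted so that the filtration starts with the whole space at `0`. -/
noncomputable def lcsFiltration (E : Type*) [NormedAddCommGroup E] [NormedSpace ℝ E]
    [CompleteSpace E] (N : Type*) [TopologicalSpace N] [ChartedSpace E N] [Group N]
    [LieGroup 𝓘(ℝ, E) ∞ N] (i : ℕ) : Submodule ℝ E :=
  (LieModule.lowerCentralSeries ℝ (GroupLieAlgebra 𝓘(ℝ, E) N)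
    (GroupLieAlgebra 𝓘(ℝ, E) N) i).toSubmodule

/-- The bracket of the Lie algebra of class `n`, transported to the model space, is nilpotent for
the filtration by the lower central series. -/
theorem isNilpotentBracket_chartBracket {E : Type*} [NormedAddCommGroup E] [NormedSpace ℝ E]
    [FiniteDimensional ℝ E] [CompleteSpace E] {N : Type*} [TopologicalSpace N] [ChartedSpace E N]
    [Group N] [LieGroup 𝓘(ℝ, E) ∞ N] {n : ℕ}
    (hn : IsNilpotentOfClass (GroupLieAlgebra 𝓘(ℝ, E) N) n) :
    IsNilpotentBracket (chartBracket E N) (lcsFiltration E N) n where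
  top := congrArg LieSubmodule.toSubmodule
    (LieModule.lowerCentralSeries_zero ℝ (GroupLieAlgebra 𝓘(ℝ, E) N) (GroupLieAlgebra 𝓘(ℝ, E) N))
  bot := congrArg LieSubmodule.toSubmodule hn.2.2
  anti := fun _ _ hij => LieModule.antitone_lowerCentralSeries ℝ (GroupLieAlgebra 𝓘(ℝ, E) N)
    (GroupLieAlgebra 𝓘(ℝ, E) N) hij
  self := fun x => (groupLieAlgebra_lie_eq N x x).symm.trans
    (lie_self (L := GroupLieAlgebra 𝓘(ℝ, E) N) x)
  mem_succ := fun i x y hy => by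
    let L := GroupLieAlgebra 𝓘(ℝ, E) N
    have h : ∀ X Y : L, Y ∈ LieModule.lowerCentralSeries ℝ L L i →
        ⁅X, Y⁆ ∈ LieModule.lowerCentralSeries ℝ L L (i + 1) := fun X Y hY => by
      rw [LieModule.lowerCentralSeries_succ]
      exact LieSubmodule.lie_mem_lie (LieSubmodule.mem_top X) hY
    exact Set.mem_of_eq_of_mem (s := (lcsFiltration E N (i + 1) : Set E))
      (groupLieAlgebra_lie_eq N x y).symm (h x y hy)

theorem mainTheorem7
    {E : Type*} [NormedAddCommGroup E] [NormedSpace ℝ E] [FiniteDimensional ℝ E] [CompleteSpace E]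
    {N : Type*} [TopologicalSpace N] [ChartedSpace E N] [Group N] [LieGroup 𝓘(ℝ, E) ∞ N]
    [SimplyConnectedSpace N] (n : ℕ)
    (hn : IsNilpotentOfClass (GroupLieAlgebra 𝓘(ℝ, E) N) n)
    (R : ℕ → Submodule ℝ (GroupLieAlgebra 𝓘(ℝ, E) N)) (hR : IsLieGrading n R) :
    (∃ Φ : E ≃ₘ⟮𝓘(ℝ, E), 𝓘(ℝ, E)⟯ N,
      ∀ X : GroupLieAlgebra 𝓘(ℝ, E) N, Φ X = lieExp X) ∧
    Function.Bijective (ofCanonicalCoordinates n R) ∧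
    (∃ p : ∀ k, LowerCoordinates R k → LowerCoordinates R k → R k,
      (∀ k, IsPolynomialMap (fun ab : LowerCoordinates R k × LowerCoordinates R k =>
        p k ab.1 ab.2)) ∧
      (∀ k a, p k a 0 = 0) ∧ (∀ k b, p k 0 b = 0) ∧
      (∀ a b, p 1 a b = 0) ∧
      ∀ a b : ∀ k, R k,
        ofCanonicalCoordinates n R a * ofCanonicalCoordinates n R b =
          ofCanonicalCoordinates n R (fun k =>
            a k + b k + p k (lowerCoordinates a k) (lowerCoordinates b k))) ∧
    (n = 2 → ∀ X Y : GroupLieAlgebra 𝓘(ℝ, E) N,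
      lieExp X * lieExp Y = lieExp (X + Y + (1 / 2 : ℝ) • ⁅X, Y⁆)) := by
  have h := isNilpotentBracket_chartBracket hn
  have hbij : Function.Bijective (modelExp N : E → N) := bijective_modelExp h hn.1
  refine ⟨exists_diffeomorph_modelExp h hn.1 hbij,
    hbij.comp (bijective_graded_sum hR.isInternal hR.zero hR.eq_bot_of_lt), ?_, ?_⟩
  · obtain ⟨p, hp, hp1, hp2, hp3, hmul⟩ := h.exists_graded_bchMul (E := E) (R := R) hn.1
      hR.isInternal hR.zero hR.eq_bot_of_lt hR.sup_eq
    exact ⟨p, hp, hp1, hp2, hp3, fun a b =>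
      (modelExp_mul_modelExp h hn.1 _ _).trans (congrArg (modelExp N) (hmul a b))⟩
  · rintro rfl X Y
    refine (modelExp_mul_modelExp h hn.1 X Y).trans (congrArg (modelExp N) ?_)
    refine (h.bchMul_two X Y).trans ?_
    exact congrArg (fun Z : E => @id E X + @id E Y + (1 / 2 : ℝ) • Z)
      (groupLieAlgebra_lie_eq N X Y).symm
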